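/- Let $d\ge 3$. For a dyadic interval $I=[m2^{-s},(m+1)2^{-s})$ let $h_I=-\mathbf 1_{I_{\rm left}}+\mathbf 1_{I_{\rm right}}$ be its $L^\infty$-normalized Haar function, and for a dyadic rectangle $R=R_1\times\cdots\times R_d\subset[0,1)^d$ let $h_R(x)=\prod_{k=1}^d h_{R_k}(x_k)$. For $n\ge 1$ let $\mathbb H_n$ be the set of $\vec r=(r_1,\dots,r_d)$ with nonnegative integer entries and $r_1+\cdots+r_d=n$. Given real coefficients $\alpha(R)$, put $$f_{\vec r}=\sum_{R\subset[0,1)^d:\ |R_k|=2^{-r_k}\ \forall k}\operatorname{sgn}(\alpha(R))\,h_R .$$ Let $0<\varepsilon<1$, $0<a\le 1$, $q=\lfloor a n^{\varepsilon}\rfloor$ and $\rho=\sqrt q\,n^{-(d-1)/2}$. Divide $\{1,\dots,n\}$ into $q$ consecutive disjoint intervals of integers $I_1,\dots,I_q$ of equal length (up to integer rounding: any two lengths differ by at most one), and set $$\mathbb A_t=\{\vec r\in\mathbb H_n: r_1\in I_t\},\qquad F_t=\sum_{\vec r\in\mathbb A_t}f_{\vec r}.$$ Let $\mathbb P$ be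 Lebesgue measure on $[0,1]^d$ and $\|\cdot\|_p$ the norm of $L^p([0,1]^d)$. **Theorem.** There are constants $0<c<1$ and $C>0$, depending only on $d$, such that for all $\varepsilon$, $a$, $n$, $\alpha$ and $I_1,\dots,I_q$ as above and all $1\le t\le q$, $$\|\rho F_t\|_p\le C\sqrt p\qquad\text{for all real } 1\le p\le c\,n^{\frac{1-2\varepsilon}{2d-1}},$$ and consequently $$\mathbb P\bigl(|\rho F_t|>x\bigr)\le C\exp(-c x^2)\qquad\text{for all } 0\le x< c\,n^{\frac{1-2\varepsilon}{4d-2}}.$$ -/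

import Mathlib

open MeasureTheory

noncomputable section

namespace SmallBall

/-- The `L^∞`-normalized Haar function `-𝟙_{left half} + 𝟙_{right half}` of the dyadic interval
`I = [m 2⁻ˢ, (m + 1) 2⁻ˢ)`. -/
def haarInterval (s m : ℕ) (x : ℝ) : ℝ :=
  -(Set.Ico ((m : ℝ) / 2 ^ s) (((m : ℝ) + 1 / 2) / 2 ^ s)).indicator (fun _ => (1 : ℝ)) x
    + (Set.Ico (((m : ℝ) + 1 / 2) / 2 ^ s) (((m : ℝ) + 1) / 2 ^ s)).indicator
        (fun _ => (1 : ℝ)) x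

/-- A dyadic rectangle `R = R_1 × ⋯ × R_d` contained in the unit cube: its `k`-th side is the
dyadic interval `[pos k * 2 ^ (-level k), (pos k + 1) * 2 ^ (-level k))`. -/
structure DyadicRect (d : ℕ) where
  level : Fin d → ℕ
  pos : (k : Fin d) → Fin (2 ^ level k)

/-- The Haar function `h_R(x) = ∏ₖ h_{R_k}(x_k)` of a dyadic rectangle. -/
def haar {d : ℕ} (R : DyadicRect d) (x : Fin d → ℝ) : ℝ :=
  ∏ k, haarInterval (R.level k) (R.pos k) (x k)

/-- `f_r = ∑_{R ∈ 𝓡_r} sgn (α R) h_R`, the sum over all dyadic rectangles `R` in the unit cube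
with `|R_k| = 2 ^ (-r_k)` for every `k`. -/
def rFun {d : ℕ} (α : DyadicRect d → ℝ) (r : Fin d → ℕ) (x : Fin d → ℝ) : ℝ :=
  ∑ m : (k : Fin d) → Fin (2 ^ r k), Real.sign (α ⟨r, m⟩) * haar ⟨r, m⟩ x

/-- `ℍ_n`: the vectors of `d` nonnegative integers with sum `n`. -/
def hyperbolic (d n : ℕ) : Finset (Fin d → ℕ) :=
  Finset.Nat.antidiagonalTuple d n

/-- The number of blocks, `q = ⌊a n^ε⌋`. -/
def blockCount (a ε : ℝ) (n : ℕ) : ℕ := ⌊a * (n : ℝ) ^ ε⌋₊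

/-- The normalization `ρ = √q n^{-(d-1)/2}`. -/
def rho (d n q : ℕ) : ℝ := √(q : ℝ) * (n : ℝ) ^ (-(((d : ℝ) - 1) / 2))

/-- `0 = e 0 ≤ e 1 ≤ ⋯ ≤ e q = n` are the cut points of a division of `{1, …, n}` into the `q`
consecutive disjoint intervals of integers `(e t, e (t + 1)]`, `t < q`, which have equal length
as far as integrality permits: any two lengths differ by at most one. (If `q ∣ n`, then all the
lengths are equal to `n / q`.) -/
structure IsEqualDivision (n q : ℕ) (e : ℕ → ℕ) : Prop where
  first : e 0 = 0
  last : e q = n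
  mono : ∀ t < q, e t ≤ e (t + 1)
  balanced : ∀ s < q, ∀ t < q, e (s + 1) - e s ≤ (e (t + 1) - e t) + 1

/-- `𝔸 = {r ∈ ℍ_n : r_1 ∈ I}` for a finite set `I` of integers; the first coordinate is the one
with index `0`. -/
def block (d n : ℕ) [NeZero d] (I : Finset ℕ) : Finset (Fin d → ℕ) :=
  (hyperbolic d n).filter (fun r => r 0 ∈ I)

/-- `F = ∑_{r ∈ 𝔸} f_r`, where `𝔸 = {r ∈ ℍ_n : r_1 ∈ I}`. -/
def blockSum {d : ℕ} [NeZero d] (n : ℕ) (α : DyadicRect d → ℝ) (I : Finset ℕ)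
    (x : Fin d → ℝ) : ℝ :=
  ∑ r ∈ block d n I, rFun α r x

/-- The probability measure of the setting: Lebesgue measure on the unit cube `[0,1]^d`. -/
def cubeMeasure (d : ℕ) : Measure (Fin d → ℝ) :=
  volume.restrict (Set.Icc 0 1)

end SmallBall

end

/-!
A point of the cube is replaced by the first `n + 1` binary digits of its coordinates, which turns
it into independent fair coins. Flipping the `r k`-th digit of coordinate `k` changes the sign of
`f_r` and the later digits of that coordinate do not matter, so `f_r` is a martingale difference in
every coordinate.

Let `S k` be the square function in the first `k` coordinates, so that `S 0 = F ^ 2`. It is the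
squared norm of a Hilbert space valued martingale in coordinate `k`, whose squared increments add up
to `S (k + 1)`. Averaging exponentials of real martingales over a Gaussian vector gives
`‖S k‖_p ≲ ‖S (k + 1)‖_p + p ‖κ k‖_{4p}`, where `κ k` is the Hilbert-Schmidt norm of the bracket.

For `k ≥ 1` the bracket is small. The coordinates strictly between `k` and the last one are frozen
one at a time by a two-point inequality, at the cost of a factor `p n` each. Since the entries of
`r` add up to `n`, what remains of an entry of the bracket is a martingale sum in the last
coordinate, unless its two indices have the same sum, which leaves few entries without cancellation.
The powers of `p` lost are absorbed by the restriction on `p`. For `k = 0` the bracket is at most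
`S 1`, so that only one factor `p` is lost in `F ^ 2`, that is, `√p` in `F`. The tail bound is
Markov's inequality with optimized `p`.
-/

noncomputable section

namespace SmallBall

open Finset ProbabilityTheory
open scoped BigOperators RealInnerProductSpace

section Moment

variable {Ω : Type*} [Fintype Ω]

/-- The nonnegative function `φ` has `k`-th moment at most `A ^ k` for the uniform measure on the
finite set `Ω`, that is, `‖φ‖_k ≤ A`. -/
structure MomentLE (φ : Ω → ℝ) (k : ℕ) (A : ℝ) : Prop where
  nonneg : ∀ ω, 0 ≤ φ ω
  bound_nonneg : 0 ≤ A
  expect_le : 𝔼 ω, φ ω ^ k ≤ A ^ k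

namespace MomentLE

variable {φ ψ : Ω → ℝ} {k : ℕ} {A B : ℝ}

lemma mono (hψ : MomentLE ψ k A) (hφ : ∀ ω, 0 ≤ φ ω) (hφψ : ∀ ω, φ ω ≤ ψ ω) (hAB : A ≤ B) :
    MomentLE φ k B :=
  ⟨hφ, hψ.bound_nonneg.trans hAB,
    (expect_le_expect fun ω _ => pow_le_pow_left₀ (hφ ω) (hφψ ω) k).trans
      (hψ.expect_le.trans (pow_le_pow_left₀ hψ.bound_nonneg hAB k))⟩

lemma of_le [Nonempty Ω] (hφ : ∀ ω, 0 ≤ φ ω) (hφA : ∀ ω, φ ω ≤ A) (k : ℕ) : MomentLE φ k A :=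
  ⟨hφ, (hφ (Classical.arbitrary Ω)).trans (hφA _),
    (expect_le_expect fun ω _ => pow_le_pow_left₀ (hφ ω) (hφA ω) k).trans
      (Fintype.expect_const (A ^ k)).le⟩

lemma const_mul (hφ : MomentLE φ k A) {c : ℝ} (hc : 0 ≤ c) :
    MomentLE (fun ω => c * φ ω) k (c * A) :=
  ⟨fun ω => mul_nonneg hc (hφ.nonneg ω), mul_nonneg hc hφ.bound_nonneg, by
    simp only [mul_pow, ← mul_expect]
    exact mul_le_mul_of_nonneg_left hφ.expect_le (pow_nonneg hc k)⟩

lemma iff_sum_rpow_le [Nonempty Ω] (hk : k ≠ 0) (hφ : ∀ ω, 0 ≤ φ ω) (hA : 0 ≤ A) :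
    MomentLE φ k A ↔
      (∑ ω, φ ω ^ (k : ℝ)) ^ (1 / (k : ℝ)) ≤ (Fintype.card Ω : ℝ) ^ (1 / (k : ℝ)) * A := by
  have hcard : (0 : ℝ) < Fintype.card Ω := by exact_mod_cast Fintype.card_pos
  have hsum : 0 ≤ ∑ ω, φ ω ^ (k : ℝ) := sum_nonneg fun ω _ => Real.rpow_nonneg (hφ ω) _
  rw [← Real.rpow_le_rpow_iff (z := k) (by positivity) (by positivity) (by positivity),
    one_div, Real.mul_rpow (by positivity) hA, Real.rpow_inv_rpow hsum (by positivity),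
    Real.rpow_inv_rpow hcard.le (by positivity)]
  simp only [Real.rpow_natCast]
  rw [← div_le_iff₀' hcard, ← Fintype.expect_eq_sum_div_card]
  exact ⟨fun h => h.expect_le, fun h => ⟨hφ, hA, h⟩⟩

lemma add (hφ : MomentLE φ k A) (hψ : MomentLE ψ k B) (hk : k ≠ 0) :
    MomentLE (fun ω => φ ω + ψ ω) k (A + B) := by
  have hsum := fun ω => add_nonneg (hφ.nonneg ω) (hψ.nonneg ω)
  have hAB := add_nonneg hφ.bound_nonneg hψ.bound_nonneg
  rcases isEmpty_or_nonempty Ω with _ | _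
  · exact ⟨hsum, hAB, by simpa using pow_nonneg hAB k⟩
  · rw [iff_sum_rpow_le hk hsum hAB, mul_add]
    exact (Real.Lp_add_le_of_nonneg univ (by exact_mod_cast Nat.one_le_iff_ne_zero.2 hk)
      (fun ω _ => hφ.nonneg ω) (fun ω _ => hψ.nonneg ω)).trans
      (add_le_add ((iff_sum_rpow_le hk hφ.nonneg hφ.bound_nonneg).1 hφ)
        ((iff_sum_rpow_le hk hψ.nonneg hψ.bound_nonneg).1 hψ))

lemma sum {ι : Type*} {s : Finset ι} {φ : ι → Ω → ℝ} {A : ι → ℝ} (hk : k ≠ 0)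
    (hφ : ∀ i ∈ s, MomentLE (φ i) k (A i)) :
    MomentLE (fun ω => ∑ i ∈ s, φ i ω) k (∑ i ∈ s, A i) := by
  classical
  induction s using Finset.induction_on with
  | empty => exact ⟨by simp, by simp, by simp [hk]⟩
  | insert i s hi ih =>
    simp only [sum_insert hi]
    exact (hφ i (mem_insert_self i s)).add (ih fun j hj => hφ j (mem_insert_of_mem hj)) hk

lemma of_pow {j : ℕ} (hφ : MomentLE (fun ω => φ ω ^ j) k (A ^ j)) (h0 : ∀ ω, 0 ≤ φ ω)
    (hA : 0 ≤ A) : MomentLE φ (j * k) A :=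
  ⟨h0, hA, by simpa only [← pow_mul] using hφ.expect_le⟩

end MomentLE

end Moment

section Gaussian

variable {E : Type*} [NormedAddCommGroup E] [InnerProductSpace ℝ E] [FiniteDimensional ℝ E]
  [MeasurableSpace E] [BorelSpace E]

lemma integral_inner_stdGaussian (v : E) : ∫ x, ⟪v, x⟫ ∂(stdGaussian E) = 0 :=
  integral_strongDual_stdGaussian (innerSL ℝ v)

lemma variance_inner_stdGaussian (v : E) : Var[fun x => ⟪v, x⟫; stdGaussian E] = ‖v‖ ^ 2 :=
  (variance_dual_stdGaussian (innerSL ℝ v)).trans (by rw [innerSL_apply_norm])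

lemma map_inner_stdGaussian (a : E) :
    (stdGaussian E).map (fun x => ⟪a, x⟫) = gaussianReal 0 (‖a‖ ^ 2).toNNReal := by
  rw [← variance_inner_stdGaussian, ← integral_inner_stdGaussian a]
  exact IsGaussian.map_eq_gaussianReal (innerSL ℝ a)

lemma integrable_exp_inner_stdGaussian (a : E) :
    Integrable (fun x => Real.exp ⟪a, x⟫) (stdGaussian E) := by
  have hexp := integrable_exp_mul_gaussianReal (μ := 0) (v := (‖a‖ ^ 2).toNNReal) 1
  rw [← map_inner_stdGaussian a, integrable_map_measure (by fun_prop) (by fun_prop)] at hexp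
  simpa [Function.comp_def] using hexp

lemma integral_exp_inner_stdGaussian (a : E) :
    ∫ x, Real.exp ⟪a, x⟫ ∂(stdGaussian E) = Real.exp (‖a‖ ^ 2 / 2) := by
  simpa [mgf] using mgf_gaussianReal (map_inner_stdGaussian a) 1

lemma integral_cexp_inner_add_inner_mul_I_stdGaussian (a t : E) :
    ∫ x, Complex.exp (⟪a, x⟫ + ⟪t, x⟫ * Complex.I) ∂(stdGaussian E) =
      Complex.exp ((‖a‖ ^ 2 - ‖t‖ ^ 2) / 2 + ⟪a, t⟫ * Complex.I) := by
  rw [stdGaussian, integral_map (Measurable.aemeasurable (by fun_prop)) (by fun_prop)]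
  set b := stdOrthonormalBasis ℝ E
  have hlin : ∀ x : Fin (Module.finrank ℝ E) → ℝ,
      Complex.exp (⟪a, ∑ i, x i • b i⟫ + ⟪t, ∑ i, x i • b i⟫ * Complex.I) =
        ∏ i, Complex.exp ((⟪a, b i⟫ + ⟪t, b i⟫ * Complex.I) * x i) := fun x => by
    rw [← Complex.exp_sum]
    simp only [inner_sum, real_inner_smul_right, Complex.ofReal_sum, Complex.ofReal_mul, sum_mul,
      ← sum_add_distrib]
    exact congrArg _ (sum_congr rfl fun i _ => by ring)
  have hmgf : ∀ z : ℂ, ∫ x : ℝ, Complex.exp (z * x) ∂(gaussianReal 0 1) =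
      Complex.exp (z ^ 2 / 2) := fun z => by
    simpa [complexMGF] using complexMGF_id_gaussianReal (μ := 0) (v := 1) z
  simp_rw [hlin]
  rw [integral_fintype_prod_eq_prod fun i (x : ℝ) =>
    Complex.exp ((⟪a, b i⟫ + ⟪t, b i⟫ * Complex.I) * x)]
  simp only [hmgf, ← Complex.exp_sum]
  simp only [← Complex.ofReal_pow, ← b.sum_sq_inner_left a, ← b.sum_sq_inner_left t,
    ← b.sum_inner_mul_inner a t, Complex.ofReal_sum, ← sum_sub_distrib, sum_div, sum_mul,
    ← sum_add_distrib]
  refine congrArg _ (sum_congr rfl fun i _ => ?_)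
  rw [real_inner_comm t]
  push_cast
  linear_combination (⟪t, b i⟫ : ℂ) ^ 2 / 2 * Complex.I_sq

lemma tilted_inner_stdGaussian (a : E) :
    (stdGaussian E).tilted (fun x => ⟪a, x⟫) = (stdGaussian E).map (· + a) := by
  have := isProbabilityMeasure_tilted (integrable_exp_inner_stdGaussian a)
  refine Measure.ext_of_charFun (funext fun t => ?_)
  have hdensity : ∀ x : E, (Real.exp ⟪a, x⟫ / Real.exp (‖a‖ ^ 2 / 2)) •
      Complex.exp (⟪x, t⟫ * Complex.I) =
        Complex.exp (-(‖a‖ ^ 2 / 2)) * Complex.exp (⟪a, x⟫ + ⟪t, x⟫ * Complex.I) := fun x => by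
    rw [← Real.exp_sub, Complex.real_smul, Complex.ofReal_exp, ← Complex.exp_add,
      ← Complex.exp_add, real_inner_comm t x]
    push_cast
    ring_nf
  rw [charFun_map_add_const, charFun_stdGaussian, charFun_apply, integral_tilted,
    integral_exp_inner_stdGaussian]
  simp_rw [hdensity]
  rw [integral_const_mul, integral_cexp_inner_add_inner_mul_I_stdGaussian, ← Complex.exp_add,
    ← Complex.exp_add]
  ring_nf

lemma integral_exp_inner_mul_stdGaussian (a : E) (F : E → ℝ) :
    ∫ x, Real.exp ⟪a, x⟫ * F x ∂(stdGaussian E) =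
      Real.exp (‖a‖ ^ 2 / 2) * ∫ x, F (x + a) ∂(stdGaussian E) := by
  have hshift : ∫ x, F (x + a) ∂(stdGaussian E) = ∫ x, F x ∂((stdGaussian E).map (· + a)) :=
    ((MeasurableEquiv.addRight a).measurableEmbedding.integral_map F).symm
  rw [hshift, ← tilted_inner_stdGaussian, integral_tilted, integral_exp_inner_stdGaussian,
    ← integral_const_mul]
  refine integral_congr_ae (ae_of_all _ fun x => ?_)
  simp only [smul_eq_mul]
  field_simp

lemma memLp_inner_add_stdGaussian (v a : E) :
    MemLp (fun x => ⟪v, x + a⟫) 2 (stdGaussian E) := by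
  simp only [inner_add_right]
  exact (IsGaussian.memLp_dual _ (innerSL ℝ v) 2 (by simp)).add (memLp_const _)

lemma integral_inner_add_stdGaussian (v a : E) :
    ∫ x, ⟪v, x + a⟫ ∂(stdGaussian E) = ⟪v, a⟫ := by
  simp only [inner_add_right]
  have hint : Integrable (fun x => ⟪v, x⟫) (stdGaussian E) :=
    IsGaussian.integrable_dual _ (innerSL ℝ v)
  simp [integral_add hint, integral_inner_stdGaussian]

lemma integral_sq_inner_add_stdGaussian (v a : E) :
    ∫ x, ⟪v, x + a⟫ ^ 2 ∂(stdGaussian E) = ‖v‖ ^ 2 + ⟪v, a⟫ ^ 2 := by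
  have hvar := variance_eq_sub (memLp_inner_add_stdGaussian v a)
  simp only [integral_inner_add_stdGaussian, Pi.pow_apply] at hvar
  rw [eq_add_of_sub_eq hvar.symm]
  simp only [inner_add_right]
  rw [variance_add_const (by fun_prop), variance_inner_stdGaussian]

variable {β : Type*} (s : Finset β) (M : E) (D : β → E)

lemma integrable_exp_inner_sub_stdGaussian (a : E) :
    Integrable (fun x => Real.exp (⟪M, x + a⟫ - (∑ b ∈ s, ⟪D b, x + a⟫ ^ 2) / 2))
      (stdGaussian E) := by
  refine ((integrable_exp_inner_stdGaussian M).mul_const (Real.exp ⟪M, a⟫)).mono' (by fun_prop)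
    (ae_of_all _ fun x => ?_)
  rw [Real.norm_eq_abs, Real.abs_exp, ← Real.exp_add, ← inner_add_right, Real.exp_le_exp]
  linarith [sum_nonneg fun b (_ : b ∈ s) => sq_nonneg ⟪D b, x + a⟫]

/-- The Gaussian measure is shifted by `M / 2`, which makes the linear term of the exponent
contribute to its mean, before Jensen's inequality is applied. -/
lemma exp_le_integral_exp_inner_sub_stdGaussian (hMD : ∑ b ∈ s, ⟪D b, M⟫ ^ 2 ≤ ‖M‖ ^ 2) :
    Real.exp (‖M‖ ^ 2 / 4 - (∑ b ∈ s, ‖D b‖ ^ 2) / 2) ≤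
      ∫ x, Real.exp (⟪M, x⟫ - (∑ b ∈ s, ⟪D b, x⟫ ^ 2) / 2) ∂(stdGaussian E) := by
  set a : E := (1 / 2 : ℝ) • M
  set Ψ : E → ℝ := fun x => ⟪a, x⟫ - (∑ b ∈ s, ⟪D b, x⟫ ^ 2) / 2
  have hsplit : ∀ x, Real.exp (⟪M, x⟫ - (∑ b ∈ s, ⟪D b, x⟫ ^ 2) / 2) =
      Real.exp ⟪a, x⟫ * Real.exp (Ψ x) := fun x => by
    rw [← Real.exp_add]
    simp only [Ψ, a, real_inner_smul_left]
    ring_nf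
  have hlin : Integrable (fun x => ⟪a, x + a⟫) (stdGaussian E) :=
    (memLp_inner_add_stdGaussian a a).integrable one_le_two
  have hsq : ∀ b ∈ s, Integrable (fun x => ⟪D b, x + a⟫ ^ 2) (stdGaussian E) :=
    fun b _ => (memLp_inner_add_stdGaussian (D b) a).integrable_sq
  have hΨint : Integrable (fun x => Ψ (x + a)) (stdGaussian E) :=
    hlin.sub ((integrable_finsetSum s hsq).div_const 2)
  have hmean : ∫ x, Ψ (x + a) ∂(stdGaussian E) =
      ‖a‖ ^ 2 - (∑ b ∈ s, (‖D b‖ ^ 2 + ⟪D b, a⟫ ^ 2)) / 2 := by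
    rw [integral_sub hlin ((integrable_finsetSum s hsq).div_const 2), integral_div,
      integral_finsetSum s hsq]
    simp only [integral_inner_add_stdGaussian, integral_sq_inner_add_stdGaussian,
      real_inner_self_eq_norm_sq]
  have hjensen := convexOn_exp.map_integral_le Real.continuous_exp.continuousOn isClosed_univ
    (ae_of_all _ fun x => Set.mem_univ (Ψ (x + a))) hΨint
    (integrable_exp_inner_sub_stdGaussian s a D a)
  simp_rw [hsplit]
  rw [integral_exp_inner_mul_stdGaussian a fun x => Real.exp (Ψ x)]
  refine le_trans ?_ (mul_le_mul_of_nonneg_left hjensen (Real.exp_pos _).le)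
  rw [hmean, ← Real.exp_add, Real.exp_le_exp, sum_add_distrib]
  have ha : ‖a‖ ^ 2 = ‖M‖ ^ 2 / 4 := by
    rw [norm_smul, mul_pow]
    norm_num
    ring
  have hDa : ∑ b ∈ s, ⟪D b, a⟫ ^ 2 = (∑ b ∈ s, ⟪D b, M⟫ ^ 2) / 4 := by
    rw [sum_div]
    exact sum_congr rfl fun b _ => by rw [real_inner_smul_right]; ring
  linarith

end Gaussian

section FlipDiff

variable {Ω : Type*}

/-- `φ` changes sign under the `i`-th permutation and is invariant under all later ones. If the
permutations flip the signs of successive fair coins, this says that `φ` is a martingale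
difference: the `i`-th coin times a function of the earlier ones. -/
structure IsFlipDiff {E : Type*} [AddGroup E] (τ : ℕ → Equiv.Perm Ω) (i : ℕ) (φ : Ω → E) :
    Prop where
  flip : ∀ ω, φ (τ i ω) = -φ ω
  inv : ∀ j, i < j → ∀ ω, φ (τ j ω) = φ ω

namespace IsFlipDiff

variable {E F : Type*} {τ : ℕ → Equiv.Perm Ω} {i : ℕ}

lemma map [AddGroup E] [AddGroup F] {G : Type*} [FunLike G E F] [AddMonoidHomClass G E F]
    {φ : Ω → E} (hφ : IsFlipDiff τ i φ) (f : G) : IsFlipDiff τ i fun ω => f (φ ω) :=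
  ⟨fun ω => by rw [hφ.flip, map_neg], fun j hj ω => by rw [hφ.inv j hj]⟩

lemma sum [AddCommGroup E] {β : Type*} {s : Finset β} {φ : β → Ω → E}
    (hφ : ∀ b ∈ s, IsFlipDiff τ i (φ b)) : IsFlipDiff τ i fun ω => ∑ b ∈ s, φ b ω :=
  ⟨fun ω => by rw [← sum_neg_distrib]; exact sum_congr rfl fun b hb => (hφ b hb).flip ω,
    fun j hj ω => sum_congr rfl fun b hb => (hφ b hb).inv j hj ω⟩

lemma mul_invariant {φ ψ : Ω → ℝ} (hφ : IsFlipDiff τ i φ)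
    (hψ : ∀ j, i ≤ j → ∀ ω, ψ (τ j ω) = ψ ω) : IsFlipDiff τ i fun ω => φ ω * ψ ω :=
  ⟨fun ω => by rw [hφ.flip, hψ i le_rfl, neg_mul],
    fun j hj ω => by rw [hφ.inv j hj, hψ j hj.le]⟩

lemma toLp {ι : Type*} {φ : ι → Ω → ℝ} (hφ : ∀ J, IsFlipDiff τ i (φ J)) :
    IsFlipDiff τ i fun ω => WithLp.toLp 2 fun J => φ J ω :=
  ⟨fun ω => by ext J; exact (hφ J).flip ω,
    fun j hj ω => by ext J; exact (hφ J).inv j hj ω⟩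

end IsFlipDiff

variable [Fintype Ω]

lemma expect_comp_perm (e : Equiv.Perm Ω) (φ : Ω → ℝ) : 𝔼 ω, φ (e ω) = 𝔼 ω, φ ω :=
  Fintype.expect_equiv e _ _ fun _ => rfl

lemma expect_eq_expect_half_add (e : Equiv.Perm Ω) (φ : Ω → ℝ) :
    𝔼 ω, φ ω = 𝔼 ω, (φ ω + φ (e ω)) / 2 := by
  rw [← expect_div, expect_add_distrib, expect_comp_perm]
  ring

lemma half_exp_add_exp_le (a x b : ℝ) :
    (Real.exp (a + x - (b + x ^ 2) / 2) + Real.exp (a - x - (b + x ^ 2) / 2)) / 2 ≤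
      Real.exp (a - b / 2) := by
  calc (Real.exp (a + x - (b + x ^ 2) / 2) + Real.exp (a - x - (b + x ^ 2) / 2)) / 2 =
        Real.exp (a - b / 2 - x ^ 2 / 2) * Real.cosh x := by
        rw [Real.cosh_eq, mul_div_assoc', mul_add, ← Real.exp_add, ← Real.exp_add]
        ring_nf
    _ ≤ Real.exp (a - b / 2 - x ^ 2 / 2) * Real.exp (x ^ 2 / 2) := by
        gcongr
        exact Real.cosh_le_exp_half_sq x
    _ = Real.exp (a - b / 2) := by rw [← Real.exp_add, sub_add_cancel]

lemma expect_exp_sum_sub_le_one [Nonempty Ω] {τ : ℕ → Equiv.Perm Ω} {D : ℕ → Ω → ℝ}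
    (hD : ∀ b, IsFlipDiff τ b (D b)) (N : ℕ) :
    𝔼 ω, Real.exp (∑ b ∈ range N, D b ω - (∑ b ∈ range N, D b ω ^ 2) / 2) ≤ 1 := by
  induction N with
  | zero => simp
  | succ N ih =>
    refine le_trans ?_ ih
    rw [expect_eq_expect_half_add (τ N)]
    refine expect_le_expect fun ω _ => ?_
    have hinv : ∀ b ∈ range N, D b (τ N ω) = D b ω :=
      fun b hb => (hD b).inv N (mem_range.1 hb) ω
    have hinv_sq : ∀ b ∈ range N, D b (τ N ω) ^ 2 = D b ω ^ 2 := fun b hb => by rw [hinv b hb]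
    simp only [sum_range_succ, sum_congr rfl hinv, sum_congr rfl hinv_sq, (hD N).flip, neg_sq,
      ← sub_eq_add_neg]
    exact half_exp_add_exp_le _ _ _

section Hilbert

variable {E : Type*} [NormedAddCommGroup E] [InnerProductSpace ℝ E] [FiniteDimensional ℝ E]

/-- The exponential of the squared norm is an average over Gaussian `x` of exponentials of the real
martingales `∑ b, ⟪x, D b⟫`. -/
lemma expect_ite_exp_norm_sq_le_one [Nonempty Ω] {τ : ℕ → Equiv.Perm Ω} {D : ℕ → Ω → E}
    (hD : ∀ b, IsFlipDiff τ b (D b)) (N : ℕ) {P : Ω → Prop} [DecidablePred P]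
    (hP : ∀ ω, P ω → ∑ b ∈ range N, ⟪D b ω, ∑ b ∈ range N, D b ω⟫ ^ 2 ≤
      ‖∑ b ∈ range N, D b ω‖ ^ 2) :
    𝔼 ω, (if P ω then Real.exp (‖∑ b ∈ range N, D b ω‖ ^ 2 / 4 -
      (∑ b ∈ range N, ‖D b ω‖ ^ 2) / 2) else 0) ≤ 1 := by
  borelize E
  set f : Ω → E → ℝ := fun ω x => Real.exp (⟪∑ b ∈ range N, D b ω, x⟫ -
    (∑ b ∈ range N, ⟪D b ω, x⟫ ^ 2) / 2)
  have hf : ∀ ω, Integrable (f ω) (stdGaussian E) := fun ω => by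
    simpa using integrable_exp_inner_sub_stdGaussian (range N) (∑ b ∈ range N, D b ω)
      (fun b => D b ω) 0
  have hmartingale : ∀ x, 𝔼 ω, f ω x ≤ 1 := fun x => by
    simpa only [f, sum_inner, innerSL_apply_apply, real_inner_comm x] using
      expect_exp_sum_sub_le_one (fun b => (hD b).map (innerSL ℝ x)) N
  calc 𝔼 ω, (if P ω then Real.exp (‖∑ b ∈ range N, D b ω‖ ^ 2 / 4 -
        (∑ b ∈ range N, ‖D b ω‖ ^ 2) / 2) else 0)
      ≤ 𝔼 ω, ∫ x, f ω x ∂(stdGaussian E) := by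
        refine expect_le_expect fun ω _ => ?_
        split_ifs with hω
        · exact exp_le_integral_exp_inner_sub_stdGaussian _ _ (fun b => D b ω) (hP ω hω)
        · exact integral_nonneg fun x => (Real.exp_pos _).le
    _ = ∫ x, 𝔼 ω, f ω x ∂(stdGaussian E) := by
        simp only [Fintype.expect_eq_sum_div_card]
        rw [integral_div, integral_finsetSum _ fun ω _ => hf ω]
    _ ≤ ∫ _, (1 : ℝ) ∂(stdGaussian E) := by
        refine integral_mono ?_ (integrable_const _) hmartingale
        simp only [Fintype.expect_eq_sum_div_card]
        exact (integrable_finsetSum _ fun ω _ => hf ω).div_const _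
    _ = 1 := by simp

end Hilbert

lemma pow_le_pow_mul_exp {x : ℝ} (hx : 0 ≤ x) (m : ℕ) : x ^ m ≤ (m : ℝ) ^ m * Real.exp x := by
  have hexp := Real.pow_div_factorial_le_exp x hx m
  rw [div_le_iff₀' (by positivity)] at hexp
  refine hexp.trans (mul_le_mul_of_nonneg_right ?_ (Real.exp_pos x).le)
  exact_mod_cast Nat.factorial_le_pow m

lemma expect_ite_pow_le {W : Ω → ℝ} (hW : ∀ ω, 0 ≤ W ω) {P : Ω → Prop} [DecidablePred P]
    {c K : ℝ} (hc : 0 < c) (hexp : 𝔼 ω, (if P ω then Real.exp (W ω / c) else 0) ≤ K) (m : ℕ) :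
    𝔼 ω, (if P ω then W ω ^ m else 0) ≤ K * (m * c) ^ m := by
  have hle : ∀ ω, (if P ω then W ω ^ m else 0) ≤
      (if P ω then Real.exp (W ω / c) else 0) * (m * c) ^ m := fun ω => by
    split_ifs
    · calc W ω ^ m = (W ω / c) ^ m * c ^ m := by rw [← mul_pow, div_mul_cancel₀ _ hc.ne']
        _ ≤ (m : ℝ) ^ m * Real.exp (W ω / c) * c ^ m := by
          gcongr
          exact pow_le_pow_mul_exp (div_nonneg (hW ω) hc.le) m
        _ = Real.exp (W ω / c) * (m * c) ^ m := by rw [mul_pow]; ring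
    · simp
  refine (expect_le_expect fun ω _ => hle ω).trans ?_
  rw [← expect_mul]
  exact mul_le_mul_of_nonneg_right hexp (by positivity)

lemma exists_le_two_pow_le {x : ℝ} (hx : 0 ≤ x) :
    ∃ i : ℕ, x ≤ 2 ^ i ∧ (2 : ℝ) ^ i ≤ 2 + 2 * x := by
  obtain ⟨i, hi, hi'⟩ := exists_nat_pow_near (x := 1 + x) (by linarith) one_lt_two
  exact ⟨i + 1, by linarith, by rw [pow_succ]; linarith⟩

lemma expect_div_pow_le {Y x : Ω → ℝ} (hY : ∀ ω, 0 ≤ Y ω) (hx : ∀ ω, 0 ≤ x ω) {K : ℝ} (m : ℕ)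
    (hYx : ∀ j : ℕ, 𝔼 ω, (if x ω ≤ 2 ^ j then Y ω else 0) ≤ K * (2 ^ j) ^ m) :
    𝔼 ω, Y ω / (2 + 2 * x ω) ^ (m + 1) ≤ 2 * K := by
  choose i hxi hix using fun ω => exists_le_two_pow_le (hx ω)
  have hi : ∀ ω, i ω ∈ range (univ.sup i + 1) := fun ω =>
    mem_range.2 (Nat.lt_succ_of_le (le_sup (f := i) (mem_univ ω)))
  have hK : 0 ≤ K := by
    refine le_trans (expect_nonneg fun ω _ => ?_) ((hYx 0).trans (by simp))
    split_ifs
    exacts [hY ω, le_rfl]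
  have hle : ∀ ω, Y ω / (2 + 2 * x ω) ^ (m + 1) ≤ ∑ j ∈ range (univ.sup i + 1),
      (if x ω ≤ 2 ^ j then Y ω else 0) / (2 ^ j) ^ (m + 1) := fun ω => by
    calc Y ω / (2 + 2 * x ω) ^ (m + 1) ≤ Y ω / (2 ^ i ω) ^ (m + 1) := by
          gcongr
          exacts [hY ω, hix ω]
      _ = (if x ω ≤ 2 ^ i ω then Y ω else 0) / (2 ^ i ω) ^ (m + 1) := by rw [if_pos (hxi ω)]
      _ ≤ _ := single_le_sum (f := fun j : ℕ =>
          (if x ω ≤ 2 ^ j then Y ω else 0) / (2 ^ j) ^ (m + 1)) (fun j _ => by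
            have := hY ω
            split_ifs <;> positivity) (hi ω)
  refine (expect_le_expect fun ω _ => hle ω).trans ?_
  rw [expect_sum_comm]
  calc ∑ j ∈ range (univ.sup i + 1), 𝔼 ω, (if x ω ≤ 2 ^ j then Y ω else 0) / (2 ^ j) ^ (m + 1)
      ≤ ∑ j ∈ range (univ.sup i + 1), K * (1 / 2) ^ j := sum_le_sum fun j _ => by
        rw [← expect_div, div_le_iff₀ (by positivity)]
        refine (hYx j).trans_eq ?_
        rw [pow_succ, one_div, inv_pow]
        field_simp
    _ ≤ K * 2 := by
        rw [← mul_sum]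
        have hgeom := summable_geometric_two.sum_le_tsum (range (univ.sup i + 1))
          fun j _ => by positivity
        exact mul_le_mul_of_nonneg_left (hgeom.trans_eq tsum_geometric_two) hK
    _ = 2 * K := mul_comm _ _

namespace MomentLE

variable {p : ℕ} {A B : ℝ}

lemma of_expect_ite_exp_le [Nonempty Ω] {W κ : Ω → ℝ} (hp : p ≠ 0) (hB : 0 < B)
    (hW : ∀ ω, 0 ≤ W ω) (hκ : MomentLE κ (4 * p) B)
    (hexp : ∀ c : ℝ, 0 < c → 𝔼 ω, (if κ ω ≤ c then Real.exp (W ω / (4 * c)) else 0) ≤ 2) :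
    MomentLE W p (256 * p * B) := by
  refine ⟨hW, by positivity, ?_⟩
  set u : Ω → ℝ := fun ω => 2 + 2 * (κ ω / B)
  have hx : ∀ ω, 0 ≤ κ ω / B := fun ω => div_nonneg (hκ.nonneg ω) hB.le
  have hu : ∀ ω, 1 ≤ u ω := fun ω => by linarith [hx ω]
  have hWu : 𝔼 ω, W ω ^ (2 * p) / u ω ^ (2 * p + 1) ≤ 2 * (2 * (8 * p * B) ^ (2 * p)) := by
    refine expect_div_pow_le (fun ω => pow_nonneg (hW ω) _) hx (2 * p) fun j => ?_
    simp only [div_le_iff₀ hB]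
    refine (expect_ite_pow_le hW (by positivity) (hexp (2 ^ j * B) (by positivity)) _).trans_eq ?_
    rw [mul_assoc, ← mul_pow]
    push_cast
    ring_nf
  have hu_moment : 𝔼 ω, u ω ^ (2 * p + 1) ≤ 4 ^ (4 * p) := by
    have hux := (of_le (φ := fun _ : Ω => (2 : ℝ)) (fun _ => zero_le_two) (fun _ => le_rfl)
      (4 * p)).add (hκ.const_mul (c := 2 / B) (by positivity)) (by omega)
    have h4 : 2 + 2 / B * B = 4 := by field_simp; norm_num
    rw [h4] at hux
    refine (expect_le_expect fun ω _ => ?_).trans hux.expect_le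
    refine (pow_le_pow_right₀ (hu ω) (show 2 * p + 1 ≤ 4 * p by omega)).trans_eq ?_
    congr 1
    simp only [u]
    ring
  have hW_sq : (𝔼 ω, W ω ^ p) ^ 2 ≤ (2 * (128 * p * B) ^ p) ^ 2 := by
    have hcs := expect_mul_sq_le_sq_mul_sq univ (fun ω => W ω ^ p / √(u ω ^ (2 * p + 1)))
      fun ω => √(u ω ^ (2 * p + 1))
    have hu0 : ∀ ω, 0 < u ω ^ (2 * p + 1) := fun ω => pow_pos (zero_lt_one.trans_le (hu ω)) _
    simp only [div_mul_cancel₀ _ (Real.sqrt_pos.2 (hu0 _)).ne', div_pow,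
      Real.sq_sqrt (hu0 _).le, ← pow_mul, mul_comm p 2] at hcs
    refine (hcs.trans (mul_le_mul hWu hu_moment (expect_nonneg fun ω _ => (hu0 ω).le)
      (by positivity))).trans_eq ?_
    rw [show (128 * p * B : ℝ) = 8 * p * B * 4 ^ 2 by ring, mul_pow _ ((4 : ℝ) ^ 2),
      ← pow_mul (4 : ℝ)]
    ring
  refine (le_of_pow_le_pow_left₀ two_ne_zero (by positivity) hW_sq).trans ?_
  rw [show (256 * p * B : ℝ) = 2 * (128 * p * B) by ring, mul_pow (2 : ℝ)]
  exact mul_le_mul_of_nonneg_right (le_self_pow₀ one_le_two hp) (by positivity)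

variable {E : Type*} [NormedAddCommGroup E] [InnerProductSpace ℝ E] [FiniteDimensional ℝ E]

lemma norm_sq_sum_of_isFlipDiff [Nonempty Ω] {τ : ℕ → Equiv.Perm Ω} {D : ℕ → Ω → E}
    (hD : ∀ b, IsFlipDiff τ b (D b)) {N : ℕ} {κ : Ω → ℝ}
    (hDκ : ∀ ω v, ∑ b ∈ range N, ⟪D b ω, v⟫ ^ 2 ≤ κ ω * ‖v‖ ^ 2) (hp : p ≠ 0) (hB : 0 < B)
    (hV : MomentLE (fun ω => ∑ b ∈ range N, ‖D b ω‖ ^ 2) p A) (hκ : MomentLE κ (4 * p) B) :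
    MomentLE (fun ω => ‖∑ b ∈ range N, D b ω‖ ^ 2) p (2 * A + 256 * p * B) := by
  set U : Ω → ℝ := fun ω => ‖∑ b ∈ range N, D b ω‖ ^ 2
  set V : Ω → ℝ := fun ω => ∑ b ∈ range N, ‖D b ω‖ ^ 2
  have hUV : ∀ c : ℝ, 0 < c →
      𝔼 ω, (if κ ω ≤ c then Real.exp ((U ω - 2 * V ω) / (4 * c)) else 0) ≤ 1 := fun c hc => by
    have hscale : ‖(√c)⁻¹‖ ^ 2 = c⁻¹ := by
      rw [Real.norm_eq_abs, sq_abs, inv_pow, Real.sq_sqrt hc.le]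
    have hscale' : (√c)⁻¹ ^ 2 = c⁻¹ := by rw [inv_pow, Real.sq_sqrt hc.le]
    have hexp := expect_ite_exp_norm_sq_le_one (P := fun ω => κ ω ≤ c)
      (fun b => (hD b).map (DistribSMul.toAddMonoidHom E (√c)⁻¹)) N fun ω hω => by
        simp only [DistribSMul.toAddMonoidHom_apply, ← smul_sum, real_inner_smul_left,
          real_inner_smul_right, norm_smul, mul_pow, hscale, hscale', ← mul_sum]
        refine mul_le_mul_of_nonneg_left ?_ (by positivity)
        rw [inv_mul_le_iff₀ hc]
        exact (hDκ ω _).trans (mul_le_mul_of_nonneg_right hω (sq_nonneg _))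
    refine le_of_eq_of_le (expect_congr rfl fun ω _ => ?_) hexp
    simp only [DistribSMul.toAddMonoidHom_apply, ← smul_sum, norm_smul, mul_pow, hscale,
      ← mul_sum]
    congr 2
    simp only [U, V]
    field_simp
    ring
  have hW : MomentLE (fun ω => max (U ω - 2 * V ω) 0) p (256 * p * B) := by
    refine of_expect_ite_exp_le hp hB (fun ω => le_max_right _ _) hκ fun c hc => ?_
    calc 𝔼 ω, (if κ ω ≤ c then Real.exp (max (U ω - 2 * V ω) 0 / (4 * c)) else 0)
        ≤ 𝔼 ω, ((if κ ω ≤ c then Real.exp ((U ω - 2 * V ω) / (4 * c)) else 0) + 1) := by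
          refine expect_le_expect fun ω _ => ?_
          split_ifs
          · rcases max_cases (U ω - 2 * V ω) 0 with ⟨hmax, -⟩ | ⟨hmax, -⟩ <;> rw [hmax]
            · exact le_add_of_nonneg_right zero_le_one
            · simp [(Real.exp_pos _).le]
          · norm_num
      _ ≤ 2 := by
          rw [expect_add_distrib, Fintype.expect_const]
          linarith [hUV c hc]
  refine ((hV.const_mul zero_le_two).add hW hp).mono (fun ω => sq_nonneg _) (fun ω => ?_) le_rfl
  linarith [le_max_left (U ω - 2 * V ω) 0]

end MomentLE

end FlipDiff

section TwoPoint

lemma sub_pow_two_mul_le_add_pow {a b : ℝ} (ha : 0 ≤ a) (hb : 0 ≤ b) (k : ℕ) :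
    (a - b) ^ (2 * k) ≤ (a + b) ^ (2 * k) := by
  rw [pow_mul, pow_mul]
  exact pow_le_pow_left₀ (sq_nonneg _) (by nlinarith [mul_nonneg ha hb]) k

lemma mul_add_pow_sub_sub_pow_le {a b : ℝ} (ha : 0 ≤ a) (hb : 0 ≤ b) (k : ℕ) :
    a * ((a + b) ^ (2 * k) - (a - b) ^ (2 * k)) ≤
      2 * k * b * ((a + b) ^ (2 * k) + (a - b) ^ (2 * k)) := by
  induction k with
  | zero => simp
  | succ k ih =>
    have hdiff := sub_pow_two_mul_le_add_pow ha hb k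
    simp only [mul_add, mul_one, pow_add] at ih ⊢
    set x := (a + b) ^ (2 * k)
    set y := (a - b) ^ (2 * k)
    have hxy : 0 ≤ x + y :=
      add_nonneg ((even_two_mul k).pow_nonneg _) ((even_two_mul k).pow_nonneg _)
    have hmain := mul_le_mul_of_nonneg_left ih (show 0 ≤ a ^ 2 + b ^ 2 by positivity)
    have hsum : 0 ≤ b ^ 3 * (x + y) := mul_nonneg (pow_nonneg hb 3) hxy
    have hrest : 0 ≤ (k + 1) * b * (a * b * (x - y)) := by
      have := sub_nonneg.2 hdiff
      positivity
    push_cast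
    linarith

lemma half_add_pow_le {a b : ℝ} (ha : 0 ≤ a) (hb : 0 ≤ b) {k K : ℕ} (hk : k ≤ K) :
    ((a + b) ^ (2 * k) + (a - b) ^ (2 * k)) / 2 ≤ (a ^ 2 + 4 * K * b ^ 2) ^ k := by
  induction k with
  | zero => simp
  | succ k ih =>
    have hdiff := mul_le_mul_of_nonneg_left (mul_add_pow_sub_sub_pow_le ha hb k) hb
    have hkK : (k : ℝ) + 1 ≤ K := by exact_mod_cast hk
    refine le_trans ?_ (mul_le_mul_of_nonneg_right (ih (by omega))
      (show 0 ≤ a ^ 2 + 4 * K * b ^ 2 by positivity))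
    simp only [mul_add, mul_one, pow_add] at hdiff ⊢
    set x := (a + b) ^ (2 * k)
    set y := (a - b) ^ (2 * k)
    have hxy : 0 ≤ x + y := add_nonneg ((even_two_mul k).pow_nonneg _)
      ((even_two_mul k).pow_nonneg _)
    have hK := mul_le_mul_of_nonneg_right hkK (show 0 ≤ b ^ 2 * (x + y) by positivity)
    have hb_sq : 0 ≤ b ^ 2 * (x + y) := by positivity
    linarith

lemma add_pow_add_sub_pow_le_of_abs_le {x y z : ℝ} (hz : |z| ≤ y) (hyx : y ≤ x) (k : ℕ) :
    (x + z) ^ k + (x - z) ^ k ≤ (x + y) ^ k + (x - y) ^ k := by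
  obtain ⟨hzy, hyz⟩ := abs_le.1 hz
  rcases ((abs_nonneg z).trans hz).eq_or_lt with rfl | hy
  · simp [abs_nonpos_iff.1 hz]
  set s := (y + z) / (2 * y)
  set t := (y - z) / (2 * y)
  have hs : 0 ≤ s := div_nonneg (by linarith) (by linarith)
  have ht : 0 ≤ t := div_nonneg (by linarith) (by linarith)
  have hst : s + t = 1 := by simp only [s, t]; field_simp; ring
  have hsty : (s - t) * y = z := by simp only [s, t]; field_simp; ring
  have hplus : x + z = s • (x + y) + t • (x - y) := by
    simp only [smul_eq_mul]
    linear_combination -x * hst - hsty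
  have hminus : x - z = t • (x + y) + s • (x - y) := by
    simp only [smul_eq_mul]
    linear_combination -x * hst + hsty
  have hadd : x + y ∈ Set.Ici (0 : ℝ) := Set.mem_Ici.2 (by linarith)
  have hsub : x - y ∈ Set.Ici (0 : ℝ) := Set.mem_Ici.2 (by linarith)
  rw [hplus, hminus]
  calc (s • (x + y) + t • (x - y)) ^ k + (t • (x + y) + s • (x - y)) ^ k
      ≤ (s • (x + y) ^ k + t • (x - y) ^ k) + (t • (x + y) ^ k + s • (x - y) ^ k) :=
        add_le_add ((convexOn_pow k).2 hadd hsub hs ht hst)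
          ((convexOn_pow k).2 hadd hsub ht hs ((add_comm t s).trans hst))
    _ = (s + t) * ((x + y) ^ k + (x - y) ^ k) := by simp only [smul_eq_mul]; ring
    _ = (x + y) ^ k + (x - y) ^ k := by rw [hst, one_mul]

lemma norm_add_pow_add_norm_sub_pow_le {F : Type*} [NormedAddCommGroup F] [InnerProductSpace ℝ F]
    {x y : F} {a b : ℝ} (hx : ‖x‖ ≤ a) (hy : ‖y‖ ≤ b) (k : ℕ) :
    ‖x + y‖ ^ (2 * k) + ‖x - y‖ ^ (2 * k) ≤ (a + b) ^ (2 * k) + (a - b) ^ (2 * k) := by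
  have ha : 0 ≤ a := (norm_nonneg x).trans hx
  have hinner : |2 * ⟪x, y⟫| ≤ 2 * (a * b) := by
    rw [abs_mul, abs_two]
    have := (abs_real_inner_le_norm x y).trans (mul_le_mul hx hy (norm_nonneg y) ha)
    linarith
  have hadd : ‖x + y‖ ^ 2 ≤ a ^ 2 + b ^ 2 + 2 * ⟪x, y⟫ := by
    rw [norm_add_sq_real]
    linarith [pow_le_pow_left₀ (norm_nonneg x) hx 2, pow_le_pow_left₀ (norm_nonneg y) hy 2]
  have hsub : ‖x - y‖ ^ 2 ≤ a ^ 2 + b ^ 2 - 2 * ⟪x, y⟫ := by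
    rw [norm_sub_sq_real]
    linarith [pow_le_pow_left₀ (norm_nonneg x) hx 2, pow_le_pow_left₀ (norm_nonneg y) hy 2]
  simp only [pow_mul]
  calc (‖x + y‖ ^ 2) ^ k + (‖x - y‖ ^ 2) ^ k
      ≤ (a ^ 2 + b ^ 2 + 2 * ⟪x, y⟫) ^ k + (a ^ 2 + b ^ 2 - 2 * ⟪x, y⟫) ^ k := by gcongr
    _ ≤ (a ^ 2 + b ^ 2 + 2 * (a * b)) ^ k + (a ^ 2 + b ^ 2 - 2 * (a * b)) ^ k :=
        add_pow_add_sub_pow_le_of_abs_le hinner (by linarith [sq_nonneg (a - b)]) k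
    _ = ((a + b) ^ 2) ^ k + ((a - b) ^ 2) ^ k := by ring

end TwoPoint

section Gram

variable {ι β : Type*}

/-- The matrix `A Bᵀ`, for matrices `A` and `B` with columns indexed by `t`, as a vector of a
Euclidean space, so that its norm is the Hilbert-Schmidt norm. -/
def crossGram (t : Finset β) (A B : ι → β → ℝ) : EuclideanSpace ℝ (ι × ι) :=
  WithLp.toLp 2 fun x => ∑ b ∈ t, A x.1 b * B x.2 b

lemma crossGram_add (t : Finset β) (A B : ι → β → ℝ) :
    crossGram t (A + B) (A + B) =
      (crossGram t A A + crossGram t B B) + (crossGram t A B + crossGram t B A) := by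
  ext x
  simp only [crossGram, PiLp.add_apply, ← sum_add_distrib, Pi.add_apply]
  exact sum_congr rfl fun b _ => by ring

lemma crossGram_sub (t : Finset β) (A B : ι → β → ℝ) :
    crossGram t (A - B) (A - B) =
      (crossGram t A A + crossGram t B B) - (crossGram t A B + crossGram t B A) := by
  ext x
  simp only [crossGram, PiLp.add_apply, PiLp.sub_apply, ← sum_add_distrib, ← sum_sub_distrib,
    Pi.sub_apply]
  exact sum_congr rfl fun b _ => by ring

variable [Fintype ι]

/-- The Hilbert-Schmidt norm of `V Vᵀ`, that is, the square of the Schatten `4`-norm of the matrix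
`V` with columns indexed by `t`. -/
def gramNorm (t : Finset β) (V : ι → β → ℝ) : ℝ := ‖crossGram t V V‖

lemma gramNorm_nonneg (t : Finset β) (V : ι → β → ℝ) : 0 ≤ gramNorm t V := norm_nonneg _

lemma norm_sq_crossGram (t : Finset β) (A B : ι → β → ℝ) :
    ‖crossGram t A B‖ ^ 2 = ∑ J, ∑ J', (∑ b ∈ t, A J b * B J' b) ^ 2 := by
  rw [EuclideanSpace.real_norm_sq_eq, Fintype.sum_prod_type]
  rfl

lemma gramNorm_sq (t : Finset β) (V : ι → β → ℝ) :
    gramNorm t V ^ 2 = ∑ J, ∑ J', (∑ b ∈ t, V J b * V J' b) ^ 2 :=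
  norm_sq_crossGram t V V

/-- The cyclicity `tr (A Bᵀ B Aᵀ) = tr (AᵀA BᵀB)` of the trace. -/
lemma norm_sq_crossGram_eq_sum_product (t : Finset β) (A B : ι → β → ℝ) :
    ‖crossGram t A B‖ ^ 2 = ∑ x ∈ t ×ˢ t, (∑ J, A J x.1 * A J x.2) * ∑ J, B J x.1 * B J x.2 := by
  calc ‖crossGram t A B‖ ^ 2
      = ∑ y : ι × ι, ∑ x ∈ t ×ˢ t, A y.1 x.1 * B y.2 x.1 * (A y.1 x.2 * B y.2 x.2) := by
        rw [norm_sq_crossGram, ← Fintype.sum_prod_type']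
        exact sum_congr rfl fun y _ => by rw [pow_two, sum_mul_sum, ← sum_product']
    _ = ∑ x ∈ t ×ˢ t, ∑ y : ι × ι, A y.1 x.1 * A y.1 x.2 * (B y.2 x.1 * B y.2 x.2) := by
        rw [sum_comm]
        exact sum_congr rfl fun x _ => sum_congr rfl fun y _ => by ring
    _ = ∑ x ∈ t ×ˢ t, (∑ J, A J x.1 * A J x.2) * ∑ J, B J x.1 * B J x.2 :=
        sum_congr rfl fun x _ => by rw [sum_mul_sum, Fintype.sum_prod_type]

lemma norm_sq_crossGram_le (t : Finset β) (A B : ι → β → ℝ) :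
    ‖crossGram t A B‖ ^ 2 ≤ gramNorm t A * gramNorm t B := by
  have hgram : ∀ V : ι → β → ℝ,
      ∑ x ∈ t ×ˢ t, (∑ J, V J x.1 * V J x.2) ^ 2 = gramNorm t V ^ 2 := fun V => by
    rw [gramNorm, norm_sq_crossGram_eq_sum_product]
    exact sum_congr rfl fun x _ => pow_two _
  refine le_of_sq_le_sq ?_ (mul_nonneg (gramNorm_nonneg t A) (gramNorm_nonneg t B))
  rw [norm_sq_crossGram_eq_sum_product, mul_pow, ← hgram, ← hgram]
  exact sum_mul_sq_le_sq_mul_sq _ _ _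

lemma gramNorm_le_sum_sq (t : Finset β) (V : ι → β → ℝ) :
    gramNorm t V ≤ ∑ b ∈ t, ∑ J, V J b ^ 2 := by
  refine le_of_sq_le_sq ?_ (sum_nonneg fun _ _ => sum_nonneg fun _ _ => sq_nonneg _)
  rw [gramNorm_sq, sum_comm (s := t), pow_two, sum_mul_sum]
  exact sum_le_sum fun J _ => sum_le_sum fun J' _ =>
    sum_mul_sq_le_sq_mul_sq t (fun b => V J b) fun b => V J' b

/-- The operator norm of `V Vᵀ` is at most its Hilbert-Schmidt norm. -/
lemma sum_inner_sq_le_gramNorm_mul (t : Finset β) (V : ι → β → ℝ) (v : EuclideanSpace ℝ ι) :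
    ∑ b ∈ t, ⟪WithLp.toLp 2 fun J => V J b, v⟫ ^ 2 ≤ gramNorm t V * ‖v‖ ^ 2 := by
  have hexpand : ∑ b ∈ t, ⟪WithLp.toLp 2 fun J => V J b, v⟫ ^ 2 =
      ∑ x : ι × ι, (∑ b ∈ t, V x.1 b * V x.2 b) * (v x.1 * v x.2) := by
    simp only [sum_mul]
    rw [sum_comm]
    refine sum_congr rfl fun b _ => ?_
    simp only [PiLp.inner_apply, RCLike.inner_apply, conj_trivial]
    rw [pow_two, sum_mul_sum, Fintype.sum_prod_type]
    exact sum_congr rfl fun J _ => sum_congr rfl fun J' _ => by ring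
  have htensor : ∑ x : ι × ι, (v x.1 * v x.2) ^ 2 = (‖v‖ ^ 2) ^ 2 := by
    rw [EuclideanSpace.real_norm_sq_eq, pow_two (∑ J, _), sum_mul_sum, Fintype.sum_prod_type]
    simp only [mul_pow]
  refine le_of_sq_le_sq ?_ (mul_nonneg (gramNorm_nonneg t V) (sq_nonneg _))
  rw [hexpand, mul_pow, ← htensor, gramNorm_sq, ← Fintype.sum_prod_type']
  exact sum_mul_sq_le_sq_mul_sq _ _ _

/-- With `s = √‖A Aᵀ‖` and `r = √‖B Bᵀ‖` the even and odd parts of the Gram matrix of `A ± B` have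
norms at most `s² + r²` and `2 s r`, which reduces the claim to the two-point inequality for
`s ± r`. -/
lemma half_gramNorm_pow_le (t : Finset β) (A B : ι → β → ℝ) (k : ℕ) :
    (gramNorm t (A + B) ^ (2 * k) + gramNorm t (A - B) ^ (2 * k)) / 2 ≤
      (gramNorm t A + 8 * k * gramNorm t B) ^ (2 * k) := by
  set s := √(gramNorm t A)
  set r := √(gramNorm t B)
  have hs : s ^ 2 = gramNorm t A := Real.sq_sqrt (gramNorm_nonneg t A)
  have hr : r ^ 2 = gramNorm t B := Real.sq_sqrt (gramNorm_nonneg t B)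
  have hs0 : 0 ≤ s := Real.sqrt_nonneg _
  have hr0 : 0 ≤ r := Real.sqrt_nonneg _
  have heven : ‖crossGram t A A + crossGram t B B‖ ≤ s ^ 2 + r ^ 2 :=
    (norm_add_le _ _).trans_eq (by rw [hs, hr]; rfl)
  have hodd : ‖crossGram t A B + crossGram t B A‖ ≤ 2 * (s * r) := by
    have hAB : ‖crossGram t A B‖ ≤ s * r := le_of_sq_le_sq
      ((norm_sq_crossGram_le t A B).trans_eq (by rw [mul_pow, hs, hr])) (mul_nonneg hs0 hr0)
    have hBA : ‖crossGram t B A‖ ≤ s * r := le_of_sq_le_sq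
      ((norm_sq_crossGram_le t B A).trans_eq (by rw [mul_pow, hs, hr, mul_comm]))
      (mul_nonneg hs0 hr0)
    linarith [norm_add_le (crossGram t A B) (crossGram t B A)]
  calc (gramNorm t (A + B) ^ (2 * k) + gramNorm t (A - B) ^ (2 * k)) / 2
      ≤ ((s ^ 2 + r ^ 2 + 2 * (s * r)) ^ (2 * k) +
          (s ^ 2 + r ^ 2 - 2 * (s * r)) ^ (2 * k)) / 2 := by
        rw [gramNorm, gramNorm, crossGram_add, crossGram_sub]
        exact div_le_div_of_nonneg_right (norm_add_pow_add_norm_sub_pow_le heven hodd k)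
          zero_le_two
    _ = ((s + r) ^ (2 * (2 * k)) + (s - r) ^ (2 * (2 * k))) / 2 := by
        rw [pow_mul (s + r) 2, pow_mul (s - r) 2]
        ring
    _ ≤ (s ^ 2 + 4 * (2 * k : ℕ) * r ^ 2) ^ (2 * k) := half_add_pow_le hs0 hr0 le_rfl
    _ = (gramNorm t A + 8 * k * gramNorm t B) ^ (2 * k) := by
        rw [hs, hr]
        push_cast
        ring

variable {Ω : Type*} [Fintype Ω]

lemma MomentLE.gramNorm_sum_of_isFlipDiff {τ : ℕ → Equiv.Perm Ω} {t : Finset β}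
    {V : ℕ → Ω → ι → β → ℝ} (hV : ∀ c, IsFlipDiff τ c (V c)) {k : ℕ} (hk : k ≠ 0) {B : ℕ → ℝ}
    (N : ℕ) (hB : ∀ c < N, MomentLE (fun ω => gramNorm t (V c ω)) (2 * k) (B c)) :
    MomentLE (fun ω => gramNorm t (∑ c ∈ range N, V c ω)) (2 * k)
      (8 * k * ∑ c ∈ range N, B c) := by
  induction N with
  | zero =>
    have hzero : gramNorm t (0 : ι → β → ℝ) = 0 :=
      pow_eq_zero_iff two_ne_zero |>.1 (by simp [gramNorm_sq])
    exact ⟨fun _ => gramNorm_nonneg _ _, by simp, by simp [hzero, hk]⟩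
  | succ N ih =>
    have hsum := (ih fun c hc => hB c (hc.trans N.lt_succ_self)).add
      ((hB N N.lt_succ_self).const_mul (c := 8 * k) (by positivity)) (by omega)
    rw [← mul_add, ← sum_range_succ] at hsum
    refine ⟨fun _ => gramNorm_nonneg _ _, hsum.bound_nonneg, le_trans ?_ hsum.expect_le⟩
    rw [expect_eq_expect_half_add (τ N)]
    refine expect_le_expect fun ω _ => ?_
    have hinv : ∀ c ∈ range N, V c (τ N ω) = V c ω :=
      fun c hc => (hV c).inv N (mem_range.1 hc) ω
    simp only [sum_range_succ, sum_congr rfl hinv, (hV N).flip, ← sub_eq_add_neg]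
    exact half_gramNorm_pow_le t _ _ k

lemma MomentLE.sq_sum_of_isFlipDiff [Nonempty Ω] {τ : ℕ → Equiv.Perm Ω} {D : ℕ → Ω → ℝ}
    (hD : ∀ c, IsFlipDiff τ c (D c)) (hD_le : ∀ c ω, |D c ω| ≤ 1) {k : ℕ} (hk : k ≠ 0) (N : ℕ) :
    MomentLE (fun ω => (∑ c ∈ range N, D c ω) ^ 2) (2 * k) (8 * k * N) := by
  have hgram : ∀ x : Unit → Unit → ℝ, gramNorm {()} x = x () () ^ 2 := fun x => by
    refine (sq_eq_sq₀ (gramNorm_nonneg _ _) (sq_nonneg _)).1 ?_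
    rw [gramNorm_sq]
    simp only [univ_unique, sum_singleton, PUnit.default_eq_unit]
    ring
  have hflip : ∀ c, IsFlipDiff τ c fun ω (_ _ : Unit) => D c ω := fun c =>
    ⟨fun ω => funext₂ fun _ _ => (hD c).flip ω, fun j hj ω => funext₂ fun _ _ => (hD c).inv j hj ω⟩
  have hmoment := gramNorm_sum_of_isFlipDiff (t := {()}) (B := fun _ => 1) hflip hk N fun c _ =>
    of_le (fun ω => gramNorm_nonneg _ _) (fun ω => by
      rw [hgram, sq_le_one_iff_abs_le_one]
      exact hD_le c ω) _
  simpa only [hgram, Finset.sum_apply, sum_const, card_range, nsmul_one] using hmoment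

end Gram

section Sums

lemma sum_sq_sum_filter_eq {R κ : Type*} [DecidableEq κ] {s : Finset R} {key : R → κ}
    {K : Finset κ} (hkey : ∀ r ∈ s, key r ∈ K) (g : R → ℝ) :
    ∑ J ∈ K, (∑ r ∈ s with key r = J, g r) ^ 2 =
      ∑ r ∈ s, ∑ r' ∈ s, if key r = key r' then g r * g r' else 0 := by
  rw [← sum_fiberwise_of_maps_to hkey]
  refine sum_congr rfl fun J _ => ?_
  rw [pow_two, sum_mul_sum]
  refine sum_congr rfl fun r hr => ?_
  rw [sum_filter, (mem_filter.1 hr).2]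
  simp only [eq_comm]

lemma abs_sum_le_one_of_card_le_one {R : Type*} {s : Finset R} (hs : #s ≤ 1) {g : R → ℝ}
    (hg : ∀ x ∈ s, |g x| ≤ 1) : |∑ x ∈ s, g x| ≤ 1 :=
  calc |∑ x ∈ s, g x| ≤ ∑ x ∈ s, |g x| := abs_sum_le_sum_abs _ _
    _ ≤ #s • (1 : ℝ) := sum_le_card_nsmul _ _ _ hg
    _ ≤ 1 := by simpa using hs

lemma eq_of_sum_eq_of_forall_ne {ι M : Type*} [Fintype ι] [AddCommMonoid M]
    [IsRightCancelAdd M] {r s : ι → M} (hsum : ∑ i, r i = ∑ i, s i) {l : ι}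
    (h : ∀ i, i ≠ l → r i = s i) : r = s := by
  classical
  rw [← add_sum_erase _ _ (mem_univ l), ← add_sum_erase _ s (mem_univ l),
    sum_congr rfl fun i hi => h i (ne_of_mem_erase hi)] at hsum
  ext i
  rcases eq_or_ne i l with rfl | hi
  exacts [add_right_cancel hsum, h i hi]

end Sums

section Trunc

variable {d : ℕ}

/-- The multi-index `r` with all coordinates from the `k`-th one on replaced by `0`; it records the
first `k` coordinates of `r`. -/
def trunc (k : ℕ) (r : Fin d → ℕ) : Fin d → ℕ := fun i => if (i : ℕ) < k then r i else 0

lemma trunc_eq_iff {k : ℕ} {r s : Fin d → ℕ} :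
    trunc k r = trunc k s ↔ ∀ i : Fin d, (i : ℕ) < k → r i = s i := by
  simp only [funext_iff, trunc]
  refine forall_congr' fun i => ?_
  split_ifs with hi <;> simp [hi]

lemma trunc_succ_eq_iff {k : Fin d} {r s : Fin d → ℕ} :
    trunc (k + 1) r = trunc (k + 1) s ↔ trunc k r = trunc k s ∧ r k = s k := by
  simp only [trunc_eq_iff, Nat.lt_succ_iff_lt_or_eq, or_imp, forall_and, Fin.val_inj, forall_eq]

lemma lt_of_sum_trunc_lt {r s : Fin d → ℕ} (hsum : ∑ i, r i = ∑ i, s i) {k : ℕ} {l : Fin d}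
    (h : ∀ i : Fin d, k ≤ i → i ≠ l → r i = s i)
    (hlt : ∑ i, trunc k r i < ∑ i, trunc k s i) : s l < r l := by
  contrapose! hlt with hrs
  have htail : ∑ i : Fin d, (r i - trunc k r i) ≤ ∑ i : Fin d, (s i - trunc k s i) := by
    refine sum_le_sum fun i _ => ?_
    simp only [trunc]
    split_ifs with hi
    · simp
    · rcases eq_or_ne i l with rfl | hil
      exacts [hrs, (h i (not_lt.1 hi) hil).le]
  have hle : ∀ u : Fin d → ℕ, ∀ i ∈ univ, trunc k u i ≤ u i := fun u i _ => by
    simp only [trunc]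
    split_ifs <;> simp
  rw [sum_tsub_distrib _ (hle r), sum_tsub_distrib _ (hle s), hsum] at htail
  have := sum_le_sum (hle r)
  have := sum_le_sum (hle s)
  omega

variable [NeZero d]

/-- The box of all multi-indices with first coordinate in `I`, the coordinates `1, …, k - 1` below
`N` and the others equal to `0`; it contains the truncations of the elements of a block. -/
def truncBox (I : Finset ℕ) (N k : ℕ) : Finset (Fin d → ℕ) :=
  Fintype.piFinset fun i => if i = 0 then I else if (i : ℕ) < k then range N else {0}

lemma card_truncBox_le (I : Finset ℕ) {N : ℕ} (hN : 0 < N) (k : ℕ) :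
    #(truncBox (d := d) I N (k + 1)) ≤ #I * N ^ k := by
  obtain _ | d := d
  · exact absurd rfl (NeZero.ne 0)
  rw [truncBox, Fintype.card_piFinset, Fin.prod_univ_succ, if_pos rfl]
  simp only [Fin.succ_ne_zero, if_false, Fin.val_succ, Nat.add_lt_add_iff_right, apply_ite card,
    card_range, card_singleton, prod_ite, prod_const, one_pow, mul_one]
  refine Nat.mul_le_mul_left _ (Nat.pow_le_pow_right hN ?_)
  rw [Fin.card_filter_val_lt]
  exact min_le_right _ _

variable {n : ℕ} {I : Finset ℕ}

lemma mem_block {r : Fin d → ℕ} : r ∈ block d n I ↔ ∑ i, r i = n ∧ r 0 ∈ I := by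
  simp [block, hyperbolic, Nat.mem_antidiagonalTuple]

lemma sum_eq_sum_of_mem_block {r s : Fin d → ℕ} (hr : r ∈ block d n I) (hs : s ∈ block d n I) :
    ∑ i, r i = ∑ i, s i :=
  (mem_block.1 hr).1.trans (mem_block.1 hs).1.symm

lemma lt_of_mem_block {r : Fin d → ℕ} (hr : r ∈ block d n I) (i : Fin d) : r i < n + 1 :=
  Nat.lt_succ_of_le ((mem_block.1 hr).1 ▸ single_le_sum (fun _ _ => Nat.zero_le _) (mem_univ i))

lemma image_trunc_subset_truncBox (k : ℕ) :
    (block d n I).image (trunc (k + 1)) ⊆ truncBox I (n + 1) (k + 1) := by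
  intro J hJ
  obtain ⟨r, hr, rfl⟩ := mem_image.1 hJ
  refine Fintype.mem_piFinset.2 fun i => ?_
  rcases eq_or_ne i 0 with rfl | hi
  · simpa [trunc] using (mem_block.1 hr).2
  · rw [if_neg hi, trunc]
    split_ifs
    exacts [mem_range.2 (lt_of_mem_block hr i), mem_singleton_self 0]

lemma card_image_trunc_le (k : ℕ) :
    #((block d n I).image (trunc (k + 1))) ≤ #I * (n + 1) ^ k :=
  (card_le_card (image_trunc_subset_truncBox k)).trans (card_truncBox_le I n.succ_pos k)

lemma card_image_trunc_filter_sum_le (k w : ℕ) :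
    #(((block d n I).image (trunc (k + 1))).filter fun J => ∑ i, J i = w) ≤ (n + 1) ^ k := by
  have hcard := card_truncBox_le (d := d) {0} n.succ_pos k
  rw [card_singleton, one_mul] at hcard
  refine (card_le_card_of_injOn (fun J => Function.update J 0 0) (fun J hJ => ?_)
    fun J hJ J' hJ' hJJ => ?_).trans hcard
  · have hbox := Fintype.mem_piFinset.1 (image_trunc_subset_truncBox k (mem_filter.1 hJ).1)
    refine Fintype.mem_piFinset.2 fun i => ?_
    rcases eq_or_ne i 0 with rfl | hi
    · simp
    · simpa [hi] using hbox i
  · refine eq_of_sum_eq_of_forall_ne ((mem_filter.1 hJ).2.trans (mem_filter.1 hJ').2.symm)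
      (l := 0) fun i hi => ?_
    simpa [hi] using congrFun hJJ i

end Trunc

/-- A family of functions indexed by multi-indices, bounded by `1`, such that `f r` is in each
coordinate `k` a martingale difference of level `r k`. -/
structure IsRFamily {Ω : Type*} {d : ℕ} (τ : Fin d → ℕ → Equiv.Perm Ω)
    (f : (Fin d → ℕ) → Ω → ℝ) : Prop where
  flipDiff : ∀ r k, IsFlipDiff (τ k) (r k) (f r)
  abs_le : ∀ r ω, |f r ω| ≤ 1

section SquareFunction

variable {Ω : Type*} {d : ℕ} {τ : Fin d → ℕ → Equiv.Perm Ω} {f : (Fin d → ℕ) → Ω → ℝ}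
  {s : Finset (Fin d → ℕ)}

/-- The square function with respect to the first `k` coordinates. -/
def squareFun (f : (Fin d → ℕ) → Ω → ℝ) (s : Finset (Fin d → ℕ)) (k : ℕ) (ω : Ω) : ℝ :=
  ∑ J ∈ s.image (trunc k), (∑ r ∈ s with trunc k r = J, f r ω) ^ 2

lemma squareFun_nonneg (s : Finset (Fin d → ℕ)) (k : ℕ) (ω : Ω) : 0 ≤ squareFun f s k ω :=
  sum_nonneg fun _ _ => sq_nonneg _

lemma squareFun_eq_sum_ite (s : Finset (Fin d → ℕ)) (k : ℕ) (ω : Ω) :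
    squareFun f s k ω =
      ∑ r ∈ s, ∑ r' ∈ s, if trunc k r = trunc k r' then f r ω * f r' ω else 0 :=
  sum_sq_sum_filter_eq (fun _ hr => mem_image_of_mem _ hr) fun r => f r ω

lemma squareFun_zero (s : Finset (Fin d → ℕ)) (ω : Ω) :
    squareFun f s 0 ω = (∑ r ∈ s, f r ω) ^ 2 := by
  rw [squareFun_eq_sum_ite, pow_two, sum_mul_sum]
  simp only [trunc_eq_iff, Nat.not_lt_zero, IsEmpty.forall_iff, implies_true, if_true]

/-- The sum of those `f r`, `r ∈ s`, for which `J` records the first `k` coordinates of `r` and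
whose `k`-th coordinate is `b`. -/
def cell (f : (Fin d → ℕ) → Ω → ℝ) (s : Finset (Fin d → ℕ)) (k : Fin d) (J : Fin d → ℕ) (b : ℕ)
    (ω : Ω) : ℝ :=
  ∑ r ∈ s with trunc k r = J ∧ r k = b, f r ω

lemma isFlipDiff_cell (hf : IsRFamily τ f) (s : Finset (Fin d → ℕ)) (k : Fin d) (J : Fin d → ℕ)
    (b : ℕ) : IsFlipDiff (τ k) b (cell f s k J b) :=
  IsFlipDiff.sum fun r hr => (mem_filter.1 hr).2.2 ▸ hf.flipDiff r k

lemma sum_cell {k : Fin d} {N : ℕ} (hN : ∀ r ∈ s, r k < N) (J : Fin d → ℕ) (ω : Ω) :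
    ∑ b ∈ range N, cell f s k J b ω = ∑ r ∈ s with trunc k r = J, f r ω := by
  simp only [cell, ← filter_filter]
  exact sum_fiberwise_of_maps_to (fun r hr => mem_range.2 (hN r (mem_filter.1 hr).1)) _

lemma squareFun_succ {k : Fin d} {N : ℕ} (hN : ∀ r ∈ s, r k < N) (ω : Ω) :
    squareFun f s (k + 1) ω =
      ∑ b ∈ range N, ∑ J : s.image (trunc (k : ℕ)), cell f s k J b ω ^ 2 := by
  have hfiber := sum_sq_sum_filter_eq (s := s) (key := fun r => (trunc (k : ℕ) r, r k))
    (K := s.image (trunc (k : ℕ)) ×ˢ range N)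
    (fun r hr => mem_product.2 ⟨mem_image_of_mem _ hr, mem_range.2 (hN r hr)⟩) fun r => f r ω
  simp only [Prod.mk.injEq, ← trunc_succ_eq_iff] at hfiber
  rw [squareFun_eq_sum_ite, ← hfiber, sum_product_right]
  refine sum_congr rfl fun b _ => ?_
  simp only [cell, Prod.mk.injEq]
  exact (sum_coe_sort _ fun J => (∑ r ∈ s with trunc k r = J ∧ r k = b, f r ω) ^ 2).symm

/-- The Hilbert-Schmidt norm of the bracket which controls the passage from the square function
in `k + 1` coordinates to the one in `k` coordinates. -/
def bracketNorm (f : (Fin d → ℕ) → Ω → ℝ) (K : Finset (Fin d → ℕ)) (N : ℕ)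
    (s : Finset (Fin d → ℕ)) (k : Fin d) (ω : Ω) : ℝ :=
  gramNorm (range N) fun (J : K) b => cell f s k J b ω

lemma bracketNorm_nonneg (K : Finset (Fin d → ℕ)) (N : ℕ) (s : Finset (Fin d → ℕ)) (k : Fin d)
    (ω : Ω) : 0 ≤ bracketNorm f K N s k ω :=
  gramNorm_nonneg _ _

lemma bracketNorm_le_squareFun {k : Fin d} {N : ℕ} (hN : ∀ r ∈ s, r k < N) (ω : Ω) :
    bracketNorm f (s.image (trunc k)) N s k ω ≤ squareFun f s (k + 1) ω := by
  rw [squareFun_succ hN]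
  exact gramNorm_le_sum_sq _ _

variable [Fintype Ω]

lemma MomentLE.squareFun_of_succ [Nonempty Ω] (hf : IsRFamily τ f) {k : Fin d} {N : ℕ}
    (hN : ∀ r ∈ s, r k < N) {p : ℕ} {A B : ℝ} (hp : p ≠ 0) (hB : 0 < B)
    (hA : MomentLE (squareFun f s (k + 1)) p A)
    (hκ : MomentLE (bracketNorm f (s.image (trunc k)) N s k) (4 * p) B) :
    MomentLE (squareFun f s k) p (2 * A + 256 * p * B) := by
  set D : ℕ → Ω → EuclideanSpace ℝ (s.image (trunc (k : ℕ))) :=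
    fun b ω => WithLp.toLp 2 fun J => cell f s k J b ω
  have hV : ∀ ω, ∑ b ∈ range N, ‖D b ω‖ ^ 2 = squareFun f s (k + 1) ω := fun ω => by
    simp only [squareFun_succ hN, D, EuclideanSpace.real_norm_sq_eq]
  have hsum : ∀ ω, ‖∑ b ∈ range N, D b ω‖ ^ 2 = squareFun f s k ω := fun ω => by
    simp only [D, EuclideanSpace.real_norm_sq_eq, WithLp.ofLp_sum, Finset.sum_apply, sum_cell hN]
    exact sum_coe_sort _ fun J => (∑ r ∈ s with trunc k r = J, f r ω) ^ 2
  have hmoment := norm_sq_sum_of_isFlipDiff (τ := τ k) (D := D) (N := N) (A := A)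
    (fun b => IsFlipDiff.toLp fun J => isFlipDiff_cell hf s k J b)
    (fun ω v => sum_inner_sq_le_gramNorm_mul _ _ v) hp hB (by simpa only [hV] using hA) hκ
  simpa only [hsum] using hmoment

lemma MomentLE.bracketNorm_of_forall_filter (hf : IsRFamily τ f) {a : Fin d} {M : ℕ}
    (hM : ∀ r ∈ s, r a < M) {K : Finset (Fin d → ℕ)} {N : ℕ} {k : Fin d} {p : ℕ} (hp : p ≠ 0)
    {B : ℝ} (hB : ∀ v, MomentLE (bracketNorm f K N (s.filter fun r => r a = v) k) (2 * p) B) :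
    MomentLE (bracketNorm f K N s k) (2 * p) (8 * p * M * B) := by
  have hcell : ∀ v J b, IsFlipDiff (τ a) v (cell f (s.filter fun r => r a = v) k J b) :=
    fun v J b => IsFlipDiff.sum fun r hr =>
      (mem_filter.1 (mem_filter.1 hr).1).2 ▸ hf.flipDiff r a
  have hmoment := gramNorm_sum_of_isFlipDiff (τ := τ a) (t := range N) (B := fun _ => B)
    (V := fun v ω (J : K) b => cell f (s.filter fun r => r a = v) k J b ω)
    (fun v => ⟨fun ω => funext₂ fun J b => (hcell v J b).flip ω,
      fun j hj ω => funext₂ fun J b => (hcell v J b).inv j hj ω⟩) hp M fun v _ => hB v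
  simp only [sum_const, card_range, nsmul_eq_mul, ← mul_assoc] at hmoment
  refine hmoment.mono (bracketNorm_nonneg K N s k) (fun ω => le_of_eq ?_) le_rfl
  rw [bracketNorm]
  congr 1
  ext J b
  simp only [cell, Finset.sum_apply, filter_comm]
  exact (sum_fiberwise_of_maps_to (fun r hr => mem_range.2 (hM r (mem_filter.1 hr).1)) _).symm

end SquareFunction

section Bracket

variable {Ω : Type*} {d : ℕ} {τ : Fin d → ℕ → Equiv.Perm Ω} {f : (Fin d → ℕ) → Ω → ℝ}
  {s : Finset (Fin d → ℕ)} {k l : Fin d}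

/-- The multi-indices in `s` all have the same coordinates at the places in `A`. -/
def IsConstOn (s : Finset (Fin d → ℕ)) (A : Finset (Fin d)) : Prop :=
  ∀ r ∈ s, ∀ r' ∈ s, ∀ a ∈ A, r a = r' a

/-- The pairs of multi-indices whose products make up the `(J, J')` entry of the bracket, see
`sum_cell_mul_cell`. -/
def cellPairs (s : Finset (Fin d → ℕ)) (k : Fin d) (J J' : Fin d → ℕ) :
    Finset ((Fin d → ℕ) × (Fin d → ℕ)) :=
  (s ×ˢ s).filter fun x => trunc k x.1 = J ∧ trunc k x.2 = J' ∧ x.1 k = x.2 k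

lemma mem_cellPairs {J J' : Fin d → ℕ} {x : (Fin d → ℕ) × (Fin d → ℕ)} :
    x ∈ cellPairs s k J J' ↔
      x.1 ∈ s ∧ x.2 ∈ s ∧ trunc k x.1 = J ∧ trunc k x.2 = J' ∧ x.1 k = x.2 k := by
  simp only [cellPairs, mem_filter, mem_product, and_assoc]

lemma sum_cell_mul_cell {N : ℕ} (hN : ∀ r ∈ s, r k < N) (J J' : Fin d → ℕ) (ω : Ω) :
    ∑ b ∈ range N, cell f s k J b ω * cell f s k J' b ω =
      ∑ x ∈ cellPairs s k J J', f x.1 ω * f x.2 ω := by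
  rw [← sum_fiberwise_of_maps_to (g := fun x => x.1 k) (t := range N)
    fun x hx => mem_range.2 (hN _ (mem_cellPairs.1 hx).1)]
  refine sum_congr rfl fun b _ => ?_
  rw [cell, cell, sum_mul_sum, ← sum_product']
  refine sum_congr (Finset.ext fun x => ?_) fun _ _ => rfl
  simp only [mem_product, mem_filter, mem_cellPairs]
  constructor
  · rintro ⟨⟨hs, hJ, hb⟩, hs', hJ', hb'⟩
    exact ⟨⟨hs, hs', hJ, hJ', hb.trans hb'.symm⟩, hb⟩
  · rintro ⟨⟨hs, hs', hJ, hJ', hkk⟩, hb⟩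
    exact ⟨⟨hs, hJ, hb⟩, hs', hJ', hkk ▸ hb⟩

variable [NeZero d] {n : ℕ} {I : Finset ℕ}

lemma IsConstOn.eq_of_trunc_eq (hconst : IsConstOn s (Ioo k l)) (hs : s ⊆ block d n I)
    (hl : IsTop l) {r r' : Fin d → ℕ} (hr : r ∈ s) (hr' : r' ∈ s) (hJ : trunc k r = trunc k r')
    (h : r k = r' k ∨ r l = r' l) : r = r' := by
  have hagree : ∀ i, i ≠ k → i ≠ l → r i = r' i := fun i hik hil => by
    rcases hik.lt_or_gt with hlt | hgt
    · exact trunc_eq_iff.1 hJ i hlt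
    · exact hconst r hr r' hr' i (mem_Ioo.2 ⟨hgt, (hl i).lt_of_ne hil⟩)
  have hsum := sum_eq_sum_of_mem_block (hs hr) (hs hr')
  rcases h with hk | hl
  · exact eq_of_sum_eq_of_forall_ne hsum (l := l) fun i hil =>
      (eq_or_ne i k).elim (fun hik => hik ▸ hk) fun hik => hagree i hik hil
  · exact eq_of_sum_eq_of_forall_ne hsum (l := k) fun i hik =>
      (eq_or_ne i l).elim (fun hil => hil ▸ hl) fun hil => hagree i hik hil

lemma IsConstOn.abs_cell_le_one (hconst : IsConstOn s (Ioo k l)) (hf : IsRFamily τ f)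
    (hs : s ⊆ block d n I) (hl : IsTop l) (J : Fin d → ℕ) (b : ℕ) (ω : Ω) :
    |cell f s k J b ω| ≤ 1 := by
  refine abs_sum_le_one_of_card_le_one (card_le_one.2 fun x hx y hy => ?_)
    fun r _ => hf.abs_le r ω
  obtain ⟨hxs, hxJ, hxb⟩ := mem_filter.1 hx
  obtain ⟨hys, hyJ, hyb⟩ := mem_filter.1 hy
  exact hconst.eq_of_trunc_eq hs hl hxs hys (hxJ.trans hyJ.symm) (Or.inl (hxb.trans hyb.symm))

lemma IsConstOn.sq_sum_cell_mul_cell_le (hconst : IsConstOn s (Ioo k l)) (hf : IsRFamily τ f)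
    (hs : s ⊆ block d n I) (hl : IsTop l) (J J' : Fin d → ℕ) (N : ℕ) (ω : Ω) :
    (∑ b ∈ range N, cell f s k J b ω * cell f s k J' b ω) ^ 2 ≤ (N : ℝ) ^ 2 := by
  rw [← sq_abs]
  refine pow_le_pow_left₀ (abs_nonneg _) ?_ 2
  calc |∑ b ∈ range N, cell f s k J b ω * cell f s k J' b ω|
      ≤ ∑ b ∈ range N, |cell f s k J b ω * cell f s k J' b ω| := abs_sum_le_sum_abs _ _
    _ ≤ ∑ _b ∈ range N, (1 : ℝ) := sum_le_sum fun b _ => by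
        rw [abs_mul]
        exact mul_le_one₀ (hconst.abs_cell_le_one hf hs hl J b ω) (abs_nonneg _)
          (hconst.abs_cell_le_one hf hs hl J' b ω)
    _ = N := by simp

lemma IsConstOn.snd_lt_fst_of_mem_cellPairs (hconst : IsConstOn s (Ioo k l))
    (hs : s ⊆ block d n I) (hl : IsTop l) {J J' : Fin d → ℕ} (hJ : ∑ i, J i < ∑ i, J' i)
    {x : (Fin d → ℕ) × (Fin d → ℕ)} (hx : x ∈ cellPairs s k J J') : x.2 l < x.1 l := by
  obtain ⟨hs₁, hs₂, rfl, rfl, hkk⟩ := mem_cellPairs.1 hx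
  refine lt_of_sum_trunc_lt (sum_eq_sum_of_mem_block (hs hs₁) (hs hs₂)) (k := k)
    (fun i hki hil => ?_) hJ
  rcases (Fin.le_def.2 hki : k ≤ i).eq_or_lt with rfl | hlt
  exacts [hkk, hconst _ hs₁ _ hs₂ i (mem_Ioo.2 ⟨hlt, (hl i).lt_of_ne hil⟩)]

lemma IsConstOn.card_filter_cellPairs_le_one (hconst : IsConstOn s (Ioo k l))
    (hs : s ⊆ block d n I) (hl : IsTop l) (J J' : Fin d → ℕ) (v : ℕ) :
    #((cellPairs s k J J').filter fun x => x.1 l = v) ≤ 1 := by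
  refine card_le_one.2 fun x hx y hy => ?_
  obtain ⟨hx, hxv⟩ := mem_filter.1 hx
  obtain ⟨hy, hyv⟩ := mem_filter.1 hy
  obtain ⟨hx₁, hx₂, hxJ, hxJ', hxk⟩ := mem_cellPairs.1 hx
  obtain ⟨hy₁, hy₂, hyJ, hyJ', hyk⟩ := mem_cellPairs.1 hy
  have hfst : x.1 = y.1 := hconst.eq_of_trunc_eq hs hl hx₁ hy₁ (hxJ.trans hyJ.symm)
    (Or.inr (hxv.trans hyv.symm))
  have hsnd : x.2 = y.2 := hconst.eq_of_trunc_eq hs hl hx₂ hy₂ (hxJ'.trans hyJ'.symm)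
    (Or.inl (by rw [← hxk, ← hyk, hfst]))
  exact Prod.ext hfst hsnd

variable [Fintype Ω] [Nonempty Ω]

/-- In a product `f x.1 * f x.2` contributing to this entry the last coordinate of `x.1` is the
larger one, so that the entry is a sum of martingale differences in the last coordinate. -/
lemma MomentLE.sq_sum_cell_mul_cell (hf : IsRFamily τ f) (hs : s ⊆ block d n I) (hl : IsTop l)
    (hconst : IsConstOn s (Ioo k l)) {p : ℕ} (hp : p ≠ 0) {J J' : Fin d → ℕ}
    (hJ : ∑ i, J i < ∑ i, J' i) :
    MomentLE (fun ω => (∑ b ∈ range (n + 1), cell f s k J b ω * cell f s k J' b ω) ^ 2) (2 * p)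
      (8 * p * (n + 1)) := by
  set D : ℕ → Ω → ℝ :=
    fun v ω => ∑ x ∈ cellPairs s k J J' with x.1 l = v, f x.1 ω * f x.2 ω
  have hflip : ∀ v, IsFlipDiff (τ l) v (D v) := fun v => IsFlipDiff.sum fun x hx => by
    obtain ⟨hxP, rfl⟩ := mem_filter.1 hx
    have hlt := hconst.snd_lt_fst_of_mem_cellPairs hs hl hJ hxP
    exact (hf.flipDiff x.1 l).mul_invariant fun j hj ω =>
      (hf.flipDiff x.2 l).inv j (hlt.trans_le hj) ω
  have hD_le : ∀ v ω, |D v ω| ≤ 1 := fun v ω =>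
    abs_sum_le_one_of_card_le_one (hconst.card_filter_cellPairs_le_one hs hl J J' v) fun x _ => by
      rw [abs_mul]
      exact mul_le_one₀ (hf.abs_le _ ω) (abs_nonneg _) (hf.abs_le _ ω)
  have hsum : ∀ ω, ∑ v ∈ range (n + 1), D v ω =
      ∑ b ∈ range (n + 1), cell f s k J b ω * cell f s k J' b ω := fun ω => by
    rw [sum_cell_mul_cell fun r hr => lt_of_mem_block (hs hr) k]
    exact sum_fiberwise_of_maps_to
      (fun x hx => mem_range.2 (lt_of_mem_block (hs (mem_cellPairs.1 hx).1) l)) _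
  simpa only [hsum, Nat.cast_succ] using sq_sum_of_isFlipDiff hflip hD_le hp (n + 1)

lemma MomentLE.sq_entry (hf : IsRFamily τ f) (hs : s ⊆ block d n I) (hl : IsTop l)
    (hconst : IsConstOn s (Ioo k l)) {p : ℕ} (hp : p ≠ 0) (J J' : Fin d → ℕ) :
    MomentLE (fun ω => (∑ b ∈ range (n + 1), cell f s k J b ω * cell f s k J' b ω) ^ 2) (2 * p)
      ((if ∑ i, J' i = ∑ i, J i then ((n : ℝ) + 1) ^ 2 else 0) + 8 * p * (n + 1)) := by
  rcases lt_trichotomy (∑ i, J i) (∑ i, J' i) with hlt | heq | hgt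
  · simpa only [if_neg hlt.ne', zero_add] using sq_sum_cell_mul_cell hf hs hl hconst hp hlt
  · rw [if_pos heq.symm]
    refine of_le (fun ω => sq_nonneg _) (fun ω => ?_) _
    refine (hconst.sq_sum_cell_mul_cell_le hf hs hl J J' (n + 1) ω).trans ?_
    push_cast
    exact le_add_of_nonneg_right (by positivity)
  · simpa only [if_neg hgt.ne, zero_add, mul_comm] using
      sq_sum_cell_mul_cell hf hs hl hconst hp hgt

lemma sum_entry_le {j : ℕ} (hj : (k : ℕ) = j + 1) {m e e' : ℝ} (hm : (#I : ℝ) ≤ m)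
    (he : 0 ≤ e) (he' : 0 ≤ e') :
    ∑ J ∈ (block d n I).image (trunc k), ∑ J' ∈ (block d n I).image (trunc k),
      ((if ∑ i, J' i = ∑ i, J i then e else 0) + e') ≤
      m * (n + 1) ^ (2 * j) * (e + m * e') := by
  set K := (block d n I).image (trunc (k : ℕ)) with hK
  have hm0 : 0 ≤ m := (Nat.cast_nonneg _).trans hm
  have hcard : (#K : ℝ) ≤ m * (n + 1) ^ j := by
    have hcard_le : #K ≤ #I * (n + 1) ^ j := by rw [hK, hj]; exact card_image_trunc_le j
    calc (#K : ℝ) ≤ #I * (n + 1) ^ j := by exact_mod_cast hcard_le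
      _ ≤ m * (n + 1) ^ j := by gcongr
  have hfiber : ∀ w, (#(K.filter fun J' => ∑ i, J' i = w) : ℝ) ≤ (n + 1) ^ j := fun w => by
    rw [hK, hj]
    exact_mod_cast card_image_trunc_filter_sum_le j w
  calc ∑ J ∈ K, ∑ J' ∈ K, ((if ∑ i, J' i = ∑ i, J i then e else 0) + e')
      ≤ ∑ _J ∈ K, ((n + 1) ^ j * e + m * (n + 1) ^ j * e') := by
        refine sum_le_sum fun J _ => ?_
        rw [sum_add_distrib, ← sum_filter, sum_const, sum_const, nsmul_eq_mul, nsmul_eq_mul]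
        gcongr
        exact hfiber _
    _ = #K * ((n + 1) ^ j * e + m * (n + 1) ^ j * e') := by rw [sum_const, nsmul_eq_mul]
    _ ≤ m * (n + 1) ^ j * ((n + 1) ^ j * e + m * (n + 1) ^ j * e') := by gcongr
    _ = m * (n + 1) ^ (2 * j) * (e + m * e') := by rw [two_mul j, pow_add]; ring

lemma MomentLE.bracketNorm_of_isConstOn (hf : IsRFamily τ f) (hs : s ⊆ block d n I)
    (hl : IsTop l) (hconst : IsConstOn s (Ioo k l)) {j : ℕ} (hj : (k : ℕ) = j + 1) {p : ℕ}
    (hp : p ≠ 0) {m : ℝ} (hm : (#I : ℝ) ≤ m) :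
    MomentLE (bracketNorm f ((block d n I).image (trunc k)) (n + 1) s k) (4 * p)
      (√(m * (n + 1) ^ (2 * j) * ((n + 1) ^ 2 + m * (8 * p * (n + 1))))) := by
  set K := (block d n I).image (trunc (k : ℕ))
  have hm0 : 0 ≤ m := (Nat.cast_nonneg _).trans hm
  have hsum := MomentLE.sum (s := K) (by omega : 2 * p ≠ 0) fun J _ =>
    MomentLE.sum (s := K) (by omega : 2 * p ≠ 0) fun J' _ => sq_entry hf hs hl hconst hp J J'
  rw [show 4 * p = 2 * (2 * p) by ring]
  refine of_pow ?_ (bracketNorm_nonneg _ _ _ _) (Real.sqrt_nonneg _)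
  rw [Real.sq_sqrt (by positivity)]
  refine hsum.mono (fun ω => sq_nonneg _) (fun ω => ?_)
    (sum_entry_le hj hm (by positivity) (by positivity))
  rw [bracketNorm, gramNorm_sq, ← sum_coe_sort K]
  exact (sum_congr rfl fun (J : K) _ => sum_coe_sort K fun J' =>
    (∑ b ∈ range (n + 1), cell f s k J b ω * cell f s k J' b ω) ^ 2).le

lemma MomentLE.bracketNorm_of_isConstOn_sdiff (hf : IsRFamily τ f) (hl : IsTop l) {j : ℕ}
    (hj : (k : ℕ) = j + 1) {p : ℕ} (hp : p ≠ 0) {m : ℝ} (hm : (#I : ℝ) ≤ m) (A : Finset (Fin d))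
    (hs : s ⊆ block d n I) (hconst : IsConstOn s (Ioo k l \ A)) :
    MomentLE (bracketNorm f ((block d n I).image (trunc k)) (n + 1) s k) (4 * p)
      ((16 * p * (n + 1)) ^ #A *
        √(m * (n + 1) ^ (2 * j) * ((n + 1) ^ 2 + m * (8 * p * (n + 1))))) := by
  induction A using Finset.induction_on generalizing s with
  | empty =>
    rw [sdiff_empty] at hconst
    simpa using bracketNorm_of_isConstOn hf hs hl hconst hj hp hm
  | insert a A ha ih =>
    have hfix : ∀ v, IsConstOn (s.filter fun r => r a = v) (Ioo k l \ A) := by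
      intro v r hr r' hr' i hi
      obtain ⟨hr, hra⟩ := mem_filter.1 hr
      obtain ⟨hr', hra'⟩ := mem_filter.1 hr'
      rcases eq_or_ne i a with rfl | hia
      · exact hra.trans hra'.symm
      · refine hconst r hr r' hr' i ?_
        simp only [mem_sdiff, mem_insert, not_or] at hi ⊢
        exact ⟨hi.1, hia, hi.2⟩
    have hmoment := bracketNorm_of_forall_filter hf (a := a) (p := 2 * p)
      (fun r hr => lt_of_mem_block (hs hr) a) (by omega) fun v => by
        rw [show 2 * (2 * p) = 4 * p by ring]
        exact ih ((filter_subset _ _).trans hs) (hfix v)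
    rw [show 2 * (2 * p) = 4 * p by ring] at hmoment
    refine hmoment.mono (bracketNorm_nonneg _ _ _ _) (fun ω => le_rfl) (le_of_eq ?_)
    rw [card_insert_of_notMem ha, pow_succ]
    push_cast
    ring

lemma MomentLE.bracketNorm_block (hf : IsRFamily τ f) {j : ℕ} (hj : (k : ℕ) = j + 1)
    {p : ℕ} (hp : p ≠ 0) {m : ℝ} (hm : (#I : ℝ) ≤ m) :
    MomentLE (bracketNorm f ((block d n I).image (trunc k)) (n + 1) (block d n I) k) (4 * p)
      ((16 * p * (n + 1)) ^ (d - 3 - j) *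
        √(m * (n + 1) ^ (2 * j) * ((n + 1) ^ 2 + m * (8 * p * (n + 1))))) := by
  have hl : IsTop (⟨d - 1, by omega⟩ : Fin d) := fun i => Fin.le_def.2 (Nat.le_sub_one_of_lt i.2)
  have hcard : #(Ioo k ⟨d - 1, by omega⟩) = d - 3 - j := by
    rw [Fin.card_Ioo, Fin.val_mk]
    omega
  rw [← hcard]
  exact bracketNorm_of_isConstOn_sdiff hf hl hj hp hm _ Subset.rfl fun r _ r' _ a ha => by
    simp at ha

end Bracket

section SquareFunctionMoments

/-- The restriction on `p` is exactly what absorbs the powers of `p` lost in the decoupling: it says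
that `p ^ (d - 2) * √(p * m) ≤ m`. -/
lemma bracket_bound_le {d p j : ℕ} {m x : ℝ} (hp : p ≠ 0) (hpm : (p : ℝ) ^ (2 * d - 3) ≤ m)
    (hmx : m ≤ x) (hj : j + 3 ≤ d) :
    256 * p * ((16 * p * x) ^ (d - 3 - j) * √(m * x ^ (2 * j) * (x ^ 2 + m * (8 * p * x)))) ≤
      768 * 16 ^ d * (m * x ^ (d - 2)) := by
  have hp1 : (1 : ℝ) ≤ p := by exact_mod_cast Nat.one_le_iff_ne_zero.2 hp
  have hm : 0 < m := (pow_pos (zero_lt_one.trans_le hp1) _).trans_le hpm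
  have hx : 0 < x := hm.trans_le hmx
  have hsqrt : √(m * x ^ (2 * j) * (x ^ 2 + m * (8 * p * x))) ≤ 3 * x ^ (j + 1) * √(p * m) := by
    refine Real.sqrt_le_iff.2 ⟨by positivity, ?_⟩
    rw [mul_pow, mul_pow, Real.sq_sqrt (by positivity)]
    calc m * x ^ (2 * j) * (x ^ 2 + m * (8 * p * x))
        ≤ m * x ^ (2 * j) * (p * x ^ 2 + x * (8 * p * x)) := by
          gcongr
          exact le_mul_of_one_le_left (by positivity) hp1
      _ = 3 ^ 2 * (x ^ (j + 1)) ^ 2 * (p * m) := by ring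
  have hdecouple : (16 * p * x : ℝ) ^ (d - 3 - j) ≤ 16 ^ d * p ^ (d - 3) * x ^ (d - 3 - j) := by
    rw [mul_pow, mul_pow]
    exact mul_le_mul_of_nonneg_right (mul_le_mul (pow_le_pow_right₀ (by norm_num) (by omega))
      (pow_le_pow_right₀ hp1 (by omega)) (by positivity) (by positivity)) (by positivity)
  have habsorb : (p : ℝ) ^ (d - 2) * √(p * m) ≤ m := by
    refine le_of_sq_le_sq ?_ hm.le
    rw [mul_pow, Real.sq_sqrt (by positivity), ← pow_mul, ← mul_assoc, ← pow_succ,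
      show (d - 2) * 2 + 1 = 2 * d - 3 by omega, pow_two]
    gcongr
  calc 256 * p * ((16 * p * x) ^ (d - 3 - j) * √(m * x ^ (2 * j) * (x ^ 2 + m * (8 * p * x))))
      ≤ 256 * p * (16 ^ d * p ^ (d - 3) * x ^ (d - 3 - j) * (3 * x ^ (j + 1) * √(p * m))) := by
        gcongr
    _ = 768 * 16 ^ d * (p ^ (d - 3 + 1) * √(p * m) * x ^ (d - 3 - j + (j + 1))) := by ring
    _ = 768 * 16 ^ d * (p ^ (d - 2) * √(p * m) * x ^ (d - 2)) := by
        rw [show d - 3 + 1 = d - 2 by omega, show d - 3 - j + (j + 1) = d - 2 by omega]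
    _ ≤ 768 * 16 ^ d * (m * x ^ (d - 2)) := by gcongr

variable {Ω : Type*} {d : ℕ} {τ : Fin d → ℕ → Equiv.Perm Ω} {f : (Fin d → ℕ) → Ω → ℝ}
  [NeZero d] {n : ℕ} {I : Finset ℕ}

lemma squareFun_block_le (hf : IsRFamily τ f) {j : ℕ} (hj : j + 2 = d) (ω : Ω) :
    squareFun f (block d n I) (j + 1) ω ≤ #I * (n + 1) ^ j := by
  have hterm : ∀ J, (∑ r ∈ block d n I with trunc (j + 1) r = J, f r ω) ^ 2 ≤ 1 := fun J => by
    rw [sq_le_one_iff_abs_le_one]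
    refine abs_sum_le_one_of_card_le_one (card_le_one.2 fun r hr r' hr' => ?_)
      fun r _ => hf.abs_le r ω
    obtain ⟨hr, hrJ⟩ := mem_filter.1 hr
    obtain ⟨hr', hrJ'⟩ := mem_filter.1 hr'
    refine eq_of_sum_eq_of_forall_ne (sum_eq_sum_of_mem_block hr hr') (l := ⟨j + 1, by omega⟩)
      fun i hi => trunc_eq_iff.1 (hrJ.trans hrJ'.symm) i ?_
    have : (i : ℕ) ≠ j + 1 := fun h => hi (Fin.ext h)
    omega
  calc squareFun f (block d n I) (j + 1) ω
      ≤ #((block d n I).image (trunc (j + 1))) • (1 : ℝ) :=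
        sum_le_card_nsmul _ _ _ fun J _ => hterm J
    _ ≤ #I * (n + 1) ^ j := by
        rw [nsmul_one]
        exact_mod_cast card_image_trunc_le j

variable [Fintype Ω] [Nonempty Ω] {m : ℝ} {p : ℕ}

lemma MomentLE.squareFun_block (hf : IsRFamily τ f) (hI : #I ≤ m) (hmn : m ≤ n + 1) (hp : p ≠ 0)
    (hpm : (p : ℝ) ^ (2 * d - 3) ≤ m) {k c : ℕ} (hkc : k + c + 2 = d) :
    MomentLE (squareFun f (block d n I) (k + 1)) p
      (3 ^ c * (768 * 16 ^ d * (m * (n + 1) ^ (d - 2)))) := by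
  have hm : 0 ≤ m := (Nat.cast_nonneg _).trans hI
  induction c generalizing k with
  | zero =>
    refine of_le (squareFun_nonneg _ _) (fun ω => ?_) p
    refine (squareFun_block_le hf (by omega) ω).trans ?_
    rw [pow_zero, one_mul, show d - 2 = k by omega]
    calc #I * ((n : ℝ) + 1) ^ k ≤ m * (n + 1) ^ k := by gcongr
      _ ≤ 768 * 16 ^ d * (m * (n + 1) ^ k) := le_mul_of_one_le_left (by positivity)
          (by linarith [one_le_pow₀ (n := d) (show (1 : ℝ) ≤ 16 by norm_num)])
  | succ c ih =>
    have hm_pos : 0 < m := lt_of_lt_of_le (by positivity) hpm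
    have hκ := bracketNorm_block (n := n) hf (k := ⟨k + 1, by omega⟩) (j := k) rfl hp hI
    have hstep := squareFun_of_succ hf (k := ⟨k + 1, by omega⟩) (N := n + 1)
      (fun r hr => lt_of_mem_block hr _) hp (by positivity) (ih (k := k + 1) (by omega)) hκ
    refine hstep.mono (squareFun_nonneg _ _) (fun ω => le_rfl) ?_
    have hbracket := bracket_bound_le hp hpm hmn (show k + 3 ≤ d by omega)
    have hgrow := le_mul_of_one_le_left (b := 768 * 16 ^ d * (m * ((n : ℝ) + 1) ^ (d - 2)))
      (by positivity) (one_le_pow₀ (n := c) (show (1 : ℝ) ≤ 3 by norm_num))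
    rw [pow_succ (3 : ℝ) c]
    linarith

/-- In the last step the bracket is bounded by the square function itself, so that its moments cost
a factor `p` only. -/
theorem MomentLE.sq_sum_block (hf : IsRFamily τ f) (hd : 2 ≤ d) (hI : #I ≤ m) (hmn : m ≤ n + 1)
    (hp : p ≠ 0) (hpm : (4 * p : ℝ) ^ (2 * d - 3) ≤ m) :
    MomentLE (fun ω => (∑ r ∈ block d n I, f r ω) ^ 2) p
      (258 * 768 * 48 ^ d * (p * (m * (n + 1) ^ (d - 2)))) := by
  set B : ℝ := 3 ^ (d - 2) * (768 * 16 ^ d * (m * (n + 1) ^ (d - 2)))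
  have hp1 : (1 : ℝ) ≤ p := by exact_mod_cast Nat.one_le_iff_ne_zero.2 hp
  have hm : 0 < m := lt_of_lt_of_le (by positivity) hpm
  have hB : 0 < B := by positivity
  have hB_le : B ≤ 3 ^ d * (768 * 16 ^ d * (m * (n + 1) ^ (d - 2))) :=
    mul_le_mul_of_nonneg_right (pow_le_pow_right₀ (by norm_num) (by omega)) (by positivity)
  have hlt : ∀ r ∈ block d n I, r 0 < n + 1 := fun r hr => lt_of_mem_block hr 0
  have hA : MomentLE (squareFun f (block d n I) 1) p B :=
    squareFun_block hf hI hmn hp (hpm.trans' (by gcongr; linarith)) (by omega)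
  have hκ : MomentLE (squareFun f (block d n I) 1) (4 * p) B :=
    squareFun_block hf hI hmn (by omega) (by push_cast; exact hpm) (by omega)
  have hstep := squareFun_of_succ hf (k := 0) hlt hp hB (by simpa using hA)
    (hκ.mono (bracketNorm_nonneg _ _ _ _) (fun ω => by
      simpa using bracketNorm_le_squareFun (f := f) (k := 0) hlt ω) le_rfl)
  refine hstep.mono (fun ω => sq_nonneg _) (fun ω => by rw [Fin.val_zero, squareFun_zero]) ?_
  calc 2 * B + 256 * p * B ≤ 258 * p * B := by nlinarith
    _ ≤ 258 * p * (3 ^ d * (768 * 16 ^ d * (m * (n + 1) ^ (d - 2)))) := by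
        gcongr
    _ = 258 * 768 * 48 ^ d * (p * (m * (n + 1) ^ (d - 2))) := by
        rw [show (48 : ℝ) = 3 * 16 by norm_num, mul_pow]
        ring

end SquareFunctionMoments

section Sample

/-- The Haar function of the `m`-th dyadic interval of a level, as a function of the index `z` of
the dyadic interval of the next level that contains the argument. -/
def haarNat (m z : ℕ) : ℝ := if z / 2 = m then -(-1) ^ z else 0

lemma haarNat_xor_one (m z : ℕ) : haarNat m (z ^^^ 1) = -haarNat m z := by
  have hpow : (-1 : ℝ) ^ (z ^^^ 1) = -(-1) ^ z := by
    obtain ⟨w, rfl | rfl⟩ := Nat.even_or_odd' z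
    · rw [Nat.xor_one_of_even (even_two_mul w), pow_succ, mul_neg_one]
    · rw [Nat.xor_one_of_odd (odd_two_mul_add_one w), Nat.add_sub_cancel, pow_succ]
      ring
  rw [haarNat, haarNat, Nat.xor_div_two, hpow, Nat.div_eq_of_lt Nat.one_lt_two, Nat.xor_zero,
    neg_ite, neg_zero]

lemma abs_haarNat (m z : ℕ) : |haarNat m z| = if z / 2 = m then 1 else 0 := by
  rw [haarNat, apply_ite abs, abs_neg, abs_neg_one_pow, abs_zero]

lemma haarInterval_eq_haarNat (s m : ℕ) {y : ℝ} (hy : 0 ≤ y) :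
    haarInterval s m y = haarNat m ⌊2 ^ (s + 1) * y⌋₊ := by
  have hz : (0 : ℝ) ≤ 2 ^ (s + 1) * y := by positivity
  have hs : (0 : ℝ) < 2 ^ s := by positivity
  have hleft : y ∈ Set.Ico ((m : ℝ) / 2 ^ s) ((m + 1 / 2) / 2 ^ s) ↔
      ⌊2 ^ (s + 1) * y⌋₊ = 2 * m := by
    rw [Nat.floor_eq_iff hz, Set.mem_Ico, div_le_iff₀ hs, lt_div_iff₀ hs, pow_succ]
    push_cast
    constructor <;> rintro ⟨hle, hlt⟩ <;> constructor <;> linarith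
  have hright : y ∈ Set.Ico (((m : ℝ) + 1 / 2) / 2 ^ s) ((m + 1) / 2 ^ s) ↔
      ⌊2 ^ (s + 1) * y⌋₊ = 2 * m + 1 := by
    rw [Nat.floor_eq_iff hz, Set.mem_Ico, div_le_iff₀ hs, lt_div_iff₀ hs, pow_succ]
    push_cast
    constructor <;> rintro ⟨hle, hlt⟩ <;> constructor <;> linarith
  rw [haarInterval, haarNat, Set.indicator_apply, Set.indicator_apply, if_congr hleft rfl rfl,
    if_congr hright rfl rfl]
  generalize ⌊2 ^ (s + 1) * y⌋₊ = z
  rcases (by omega : z = 2 * m ∨ z = 2 * m + 1 ∨ z / 2 ≠ m) with rfl | rfl | hne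
  · simp
  · simp [pow_succ, show (2 * m + 1) / 2 = m by omega]
  · rw [if_neg (by omega), if_neg (by omega), if_neg hne, neg_zero, zero_add]

/-- The flip of the `j`-th most significant of the `L` binary digits of a number; the identity if
there is no such digit. -/
def flipDigit (L j : ℕ) : Equiv.Perm (Fin (2 ^ L)) :=
  Function.Involutive.toPerm
    (fun x => if h : j < L then ⟨x ^^^ 2 ^ (L - (j + 1)), Nat.xor_lt_two_pow x.2
      (Nat.pow_lt_pow_right one_lt_two (by omega))⟩ else x)
    (fun x => by
      by_cases h : j < L
      · simp only [h, dif_pos]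
        exact Fin.ext (by simp)
      · simp [h])

lemma flipDigit_div_self {L j : ℕ} (h : j < L) (x : Fin (2 ^ L)) :
    (flipDigit L j x : ℕ) / 2 ^ (L - (j + 1)) = (x / 2 ^ (L - (j + 1))) ^^^ 1 := by
  simp [flipDigit, h, Nat.xor_div_two_pow]

lemma flipDigit_div_of_lt {L s j : ℕ} (hs : s < j) (x : Fin (2 ^ L)) :
    (flipDigit L j x : ℕ) / 2 ^ (L - (s + 1)) = x / 2 ^ (L - (s + 1)) := by
  by_cases h : j < L
  · have hdiv : 2 ^ (L - (j + 1)) / 2 ^ (L - (s + 1)) = 0 :=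
      Nat.div_eq_of_lt (Nat.pow_lt_pow_right one_lt_two (by omega))
    simp [flipDigit, h, Nat.xor_div_two_pow, hdiv]
  · simp [flipDigit, h]

variable {d : ℕ}

/-- The flip of the `j`-th digit of the `k`-th coordinate of a point of the finite model
`Fin d → Fin (2 ^ L)` of the cube. -/
def flipCoord (L : ℕ) (k : Fin d) (j : ℕ) : Equiv.Perm (Fin d → Fin (2 ^ L)) :=
  Equiv.piCongrRight fun i => if i = k then flipDigit L j else Equiv.refl _

lemma prod_flipCoord {M : Type*} [CommMonoid M] {L : ℕ} (k : Fin d) (j : ℕ)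
    (ω : Fin d → Fin (2 ^ L)) (g : Fin d → Fin (2 ^ L) → M) :
    ∏ i, g i (flipCoord L k j ω i) =
      g k (flipDigit L j (ω k)) * ∏ i ∈ univ.erase k, g i (ω i) := by
  rw [← mul_prod_erase univ _ (mem_univ k)]
  congr 1
  · simp [flipCoord]
  · exact prod_congr rfl fun i hi => by simp [flipCoord, ne_of_mem_erase hi]

/-- The function `f_r` on the finite model; it is `0` if the model is too coarse. -/
def rSample (α : DyadicRect d → ℝ) (L : ℕ) (r : Fin d → ℕ) (ω : Fin d → Fin (2 ^ L)) : ℝ :=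
  if ∀ k, r k < L then
    ∑ m : (k : Fin d) → Fin (2 ^ r k), Real.sign (α ⟨r, m⟩) *
      ∏ k, haarNat (m k) (ω k / 2 ^ (L - (r k + 1)))
  else 0

lemma isFlipDiff_rSample (α : DyadicRect d → ℝ) (L : ℕ) (r : Fin d → ℕ) (k : Fin d) :
    IsFlipDiff (flipCoord L k) (r k) (rSample α L r) := by
  by_cases hr : ∀ k, r k < L
  · have hprod (m : (k : Fin d) → Fin (2 ^ r k)) (j : ℕ) (ω : Fin d → Fin (2 ^ L)) :=
      prod_flipCoord k j ω fun i x => haarNat (m i) (x / 2 ^ (L - (r i + 1)))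
    constructor
    · intro ω
      simp only [rSample, if_pos hr, ← sum_neg_distrib]
      refine sum_congr rfl fun m _ => ?_
      rw [hprod, flipDigit_div_self (hr k), haarNat_xor_one, neg_mul, mul_neg,
        ← mul_prod_erase univ _ (mem_univ k)]
    · intro j hj ω
      simp only [rSample, if_pos hr]
      refine sum_congr rfl fun m _ => ?_
      rw [hprod, flipDigit_div_of_lt hj, ← mul_prod_erase univ _ (mem_univ k)]
  · exact ⟨fun ω => by simp [rSample, hr], fun j _ ω => by simp [rSample, hr]⟩

lemma abs_sign_le_one (x : ℝ) : |Real.sign x| ≤ 1 := by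
  rcases Real.sign_apply_eq x with h | h | h <;> simp [h]

/-- At every point at most one of the Haar functions of the same shape does not vanish. -/
lemma abs_sum_mul_prod_haarNat_le_one {N : Fin d → ℕ} {β : ((k : Fin d) → Fin (N k)) → ℝ}
    (hβ : ∀ m, |β m| ≤ 1) (z : Fin d → ℕ) :
    |∑ m : (k : Fin d) → Fin (N k), β m * ∏ k, haarNat (m k) (z k)| ≤ 1 := by
  have hcard : ∀ k, #{m : Fin (N k) | z k / 2 = m} ≤ 1 := fun k =>
    card_le_one.2 fun a ha b hb => Fin.ext ((mem_filter.1 ha).2.symm.trans (mem_filter.1 hb).2)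
  calc |∑ m : (k : Fin d) → Fin (N k), β m * ∏ k, haarNat (m k) (z k)|
      ≤ ∑ m : (k : Fin d) → Fin (N k), |β m * ∏ k, haarNat (m k) (z k)| :=
        abs_sum_le_sum_abs _ _
    _ ≤ ∑ m : (k : Fin d) → Fin (N k), ∏ k, |haarNat (m k) (z k)| :=
        sum_le_sum fun m _ => by
          rw [abs_mul, abs_prod]
          exact mul_le_of_le_one_left (prod_nonneg fun k _ => abs_nonneg _) (hβ m)
    _ = ∏ k, (#{m : Fin (N k) | z k / 2 = m} : ℝ) := by
        rw [← Fintype.prod_sum fun k (m : Fin (N k)) => |haarNat m (z k)|]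
        simp only [abs_haarNat, sum_boole]
    _ ≤ 1 := prod_le_one (fun k _ => Nat.cast_nonneg _) fun k _ => by exact_mod_cast hcard k

lemma isRFamily_rSample (α : DyadicRect d → ℝ) (L : ℕ) :
    IsRFamily (flipCoord L) (rSample α L) where
  flipDiff := isFlipDiff_rSample α L
  abs_le r ω := by
    rw [rSample]
    split_ifs
    · exact abs_sum_mul_prod_haarNat_le_one (fun m => abs_sign_le_one _) _
    · simp

/-- The index of the dyadic interval of length `2⁻ᴸ` which contains a point of `[0, 1)`; outside
of `[0, 1)` the value is meaningless. -/
def digits (L : ℕ) (y : ℝ) : Fin (2 ^ L) :=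
  ⟨⌊2 ^ L * y⌋₊ % 2 ^ L, Nat.mod_lt _ (by positivity)⟩

lemma measurable_digits (L : ℕ) : Measurable (digits L) := by
  have h : Measurable fun k : ℕ => (⟨k % 2 ^ L, Nat.mod_lt _ (by positivity)⟩ : Fin (2 ^ L)) :=
    measurable_from_top
  exact h.comp (Nat.measurable_floor.comp (measurable_const_mul _))

lemma coe_digits {L : ℕ} {y : ℝ} (hy : y ∈ Set.Ico (0 : ℝ) 1) :
    (digits L y : ℕ) = ⌊2 ^ L * y⌋₊ := by
  refine Nat.mod_eq_of_lt ((Nat.floor_lt (mul_nonneg (by positivity) hy.1)).2 ?_)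
  push_cast
  exact mul_lt_of_lt_one_right (by positivity) hy.2

lemma digits_div {L s : ℕ} (hs : s ≤ L) {y : ℝ} (hy : y ∈ Set.Ico (0 : ℝ) 1) :
    (digits L y : ℕ) / 2 ^ (L - s) = ⌊2 ^ s * y⌋₊ := by
  rw [coe_digits hy, ← Nat.floor_div_natCast]
  congr 1
  rw [← pow_mul_pow_sub (2 : ℝ) hs]
  push_cast
  field_simp

lemma preimage_digits_inter_Ico (L : ℕ) (x : Fin (2 ^ L)) :
    digits L ⁻¹' {x} ∩ Set.Ico (0 : ℝ) 1 = Set.Ico ((x : ℝ) / 2 ^ L) (((x : ℝ) + 1) / 2 ^ L) := by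
  have hpos : (0 : ℝ) < 2 ^ L := by positivity
  have hx : ((x : ℕ) : ℝ) + 1 ≤ 2 ^ L := by exact_mod_cast x.2
  have hiff {y : ℝ} (hy : y ∈ Set.Ico (0 : ℝ) 1) : digits L y = x ↔
      y ∈ Set.Ico ((x : ℝ) / 2 ^ L) (((x : ℝ) + 1) / 2 ^ L) := by
    rw [Fin.ext_iff, coe_digits hy, Nat.floor_eq_iff (mul_nonneg hpos.le hy.1), Set.mem_Ico,
      div_le_iff₀ hpos, lt_div_iff₀ hpos, mul_comm]
  have hsub : Set.Ico ((x : ℝ) / 2 ^ L) (((x : ℝ) + 1) / 2 ^ L) ⊆ Set.Ico 0 1 :=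
    Set.Ico_subset_Ico (by positivity) ((div_le_one hpos).2 hx)
  ext y
  exact ⟨fun h => (hiff h.2).1 h.1, fun h => ⟨(hiff (hsub h)).2 h, hsub h⟩⟩

lemma map_digits_singleton (L : ℕ) (x : Fin (2 ^ L)) :
    ((volume.restrict (Set.Ico (0 : ℝ) 1)).map (digits L)) {x} = (2 ^ L : ENNReal)⁻¹ := by
  rw [Measure.map_apply (measurable_digits L) (measurableSet_singleton x),
    Measure.restrict_apply (measurable_digits L (measurableSet_singleton x)),
    preimage_digits_inter_Ico, Real.volume_Ico, ← sub_div, add_sub_cancel_left, one_div,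
    ENNReal.ofReal_inv_of_pos (by positivity), ENNReal.ofReal_pow zero_le_two,
    ENNReal.ofReal_ofNat]

lemma cubeMeasure_eq_pi (d : ℕ) :
    cubeMeasure d = Measure.pi fun _ : Fin d => volume.restrict (Set.Ico (0 : ℝ) 1) := by
  rw [cubeMeasure, ← Measure.restrict_pi_pi, ← volume_pi]
  exact Measure.restrict_congr_set (Measure.univ_pi_Ico_ae_eq_Icc (μ := fun _ : Fin d => volume)
    (f := 0) (g := 1)).symm

instance (d : ℕ) : IsProbabilityMeasure (cubeMeasure d) := by
  have : IsProbabilityMeasure (volume.restrict (Set.Ico (0 : ℝ) 1)) := ⟨by simp⟩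
  rw [cubeMeasure_eq_pi]
  infer_instance

lemma ae_mem_Ico (d : ℕ) : ∀ᵐ y ∂(cubeMeasure d), ∀ k, y k ∈ Set.Ico (0 : ℝ) 1 := by
  rw [cubeMeasure_eq_pi, ← Measure.restrict_pi_pi]
  filter_upwards [ae_restrict_mem (MeasurableSet.univ_pi fun _ => measurableSet_Ico)] with y hy k
  exact hy k (Set.mem_univ k)

/-- The point of the finite model given by the first `L` digits of each coordinate. -/
def cubeDigits (L : ℕ) (y : Fin d → ℝ) (k : Fin d) : Fin (2 ^ L) := digits L (y k)

lemma measurable_cubeDigits (L : ℕ) : Measurable (cubeDigits (d := d) L) :=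
  measurable_pi_lambda _ fun k => (measurable_digits L).comp (measurable_pi_apply k)

lemma lintegral_comp_cubeDigits (L : ℕ) (φ : (Fin d → Fin (2 ^ L)) → ENNReal) :
    ∫⁻ y, φ (cubeDigits L y) ∂(cubeMeasure d) =
      ∑ ω, φ ω * (Fintype.card (Fin d → Fin (2 ^ L)) : ENNReal)⁻¹ := by
  have hmap : (cubeMeasure d).map (cubeDigits L) =
      Measure.pi fun _ => (volume.restrict (Set.Ico (0 : ℝ) 1)).map (digits L) := by
    rw [cubeMeasure_eq_pi]
    exact Measure.pi_map_pi fun _ => (measurable_digits L).aemeasurable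
  rw [← lintegral_map (Measurable.of_discrete (f := φ)) (measurable_cubeDigits L),
    lintegral_fintype, hmap]
  refine sum_congr rfl fun ω _ => ?_
  simp only [Measure.pi_singleton, map_digits_singleton]
  simp [ENNReal.inv_pow]

lemma rFun_eq_rSample (α : DyadicRect d → ℝ) {L : ℕ} {r : Fin d → ℕ} (hr : ∀ k, r k < L)
    {y : Fin d → ℝ} (hy : ∀ k, y k ∈ Set.Ico (0 : ℝ) 1) :
    rFun α r y = rSample α L r (cubeDigits L y) := by
  rw [rFun, rSample, if_pos hr]
  refine sum_congr rfl fun m _ => congrArg _ (prod_congr rfl fun k _ => ?_)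
  rw [haarInterval_eq_haarNat _ _ (hy k).1, cubeDigits, digits_div (hr k) (hy k)]

end Sample

section BlockSum

lemma IsEqualDivision.sum_range {n q : ℕ} {e : ℕ → ℕ} (h : IsEqualDivision n q e) :
    ∑ s ∈ range q, (e (s + 1) - e s) = n := by
  have htel : ∀ k ≤ q, ∑ s ∈ range k, (e (s + 1) - e s) = e k := fun k => by
    induction k with
    | zero => simp [h.first]
    | succ k ih =>
      intro hk
      rw [sum_range_succ, ih (by omega), Nat.add_sub_cancel' (h.mono k hk)]
  rw [htel q le_rfl, h.last]

lemma IsEqualDivision.mul_le {n q t : ℕ} {e : ℕ → ℕ} (h : IsEqualDivision n q e) (ht : t < q) :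
    q * (e (t + 1) - e t) ≤ n + q :=
  calc q * (e (t + 1) - e t) = ∑ _s ∈ range q, (e (t + 1) - e t) := by simp
    _ ≤ ∑ s ∈ range q, ((e (s + 1) - e s) + 1) :=
        sum_le_sum fun s hs => h.balanced t ht s (mem_range.1 hs)
    _ = n + q := by simp [sum_add_distrib, h.sum_range]

lemma blockCount_le {a : ℝ} (ha : 0 ≤ a) (ha1 : a ≤ 1) (ε : ℝ) (n : ℕ) :
    (blockCount a ε n : ℝ) ≤ (n : ℝ) ^ ε :=
  (Nat.floor_le (by positivity)).trans (mul_le_of_le_one_left (by positivity) ha1)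

variable {d : ℕ}

lemma aestronglyMeasurable_comp_cubeDigits (L : ℕ) (g : (Fin d → Fin (2 ^ L)) → ℝ) :
    AEStronglyMeasurable (fun y => g (cubeDigits L y)) (cubeMeasure d) :=
  ((Measurable.of_discrete (f := g)).comp (measurable_cubeDigits L)).aestronglyMeasurable

lemma MomentLE.eLpNorm_comp_cubeDigits_le {L p : ℕ} {A : ℝ} {g : (Fin d → Fin (2 ^ L)) → ℝ}
    (hp : p ≠ 0) (h : MomentLE (fun ω => g ω ^ 2) p A) :
    eLpNorm (fun y => g (cubeDigits L y)) ((2 * p : ℕ) : ENNReal) (cubeMeasure d) ≤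
      ENNReal.ofReal √A := by
  have hp_pos : (0 : ℝ) < (2 * p : ℕ) := by positivity
  have henorm : ∀ ω, ‖g ω‖ₑ ^ ((2 * p : ℕ) : ℝ) = ENNReal.ofReal ((g ω ^ 2) ^ p) := fun ω => by
    rw [ENNReal.rpow_natCast, Real.enorm_eq_ofReal_abs, ← ENNReal.ofReal_pow (abs_nonneg _),
      pow_mul, sq_abs]
  have hcard : (Fintype.card (Fin d → Fin (2 ^ L)) : ENNReal)⁻¹ =
      ENNReal.ofReal (Fintype.card (Fin d → Fin (2 ^ L)) : ℝ)⁻¹ := by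
    rw [ENNReal.ofReal_inv_of_pos (by exact_mod_cast Fintype.card_pos), ENNReal.ofReal_natCast]
  have hexpect := h.expect_le
  rw [Fintype.expect_eq_sum_div_card, div_eq_mul_inv] at hexpect
  rw [eLpNorm_eq_lintegral_rpow_enorm_toReal (by simp [hp]) (ENNReal.natCast_ne_top _),
    ENNReal.toReal_natCast, lintegral_comp_cubeDigits L fun ω => ‖g ω‖ₑ ^ ((2 * p : ℕ) : ℝ),
    one_div, ENNReal.rpow_inv_le_iff hp_pos, ENNReal.rpow_natCast,
    ← ENNReal.ofReal_pow (Real.sqrt_nonneg _), pow_mul, Real.sq_sqrt h.bound_nonneg]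
  simp only [henorm, hcard]
  rw [← sum_mul, ← ENNReal.ofReal_sum_of_nonneg fun ω _ => by positivity,
    ← ENNReal.ofReal_mul (sum_nonneg fun ω _ => by positivity)]
  exact ENNReal.ofReal_le_ofReal hexpect

variable [NeZero d]

lemma blockSum_ae_eq (n : ℕ) (α : DyadicRect d → ℝ) (I : Finset ℕ) :
    blockSum n α I =ᵐ[cubeMeasure d]
      fun y => ∑ r ∈ block d n I, rSample α (n + 1) r (cubeDigits (n + 1) y) := by
  filter_upwards [ae_mem_Ico d] with y hy
  exact sum_congr rfl fun r hr => rFun_eq_rSample α (fun k => lt_of_mem_block hr k) hy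

lemma aestronglyMeasurable_blockSum (n : ℕ) (α : DyadicRect d → ℝ) (I : Finset ℕ) :
    AEStronglyMeasurable (blockSum n α I) (cubeMeasure d) :=
  (aestronglyMeasurable_comp_cubeDigits (n + 1) fun ω =>
    ∑ r ∈ block d n I, rSample α (n + 1) r ω).congr (blockSum_ae_eq n α I).symm

lemma rho_sq (n q : ℕ) : rho d n q ^ 2 = q / (n : ℝ) ^ (d - 1) := by
  have hd : 1 ≤ d := Nat.one_le_iff_ne_zero.2 (NeZero.ne d)
  rw [rho, mul_pow, Real.sq_sqrt q.cast_nonneg, ← Real.rpow_natCast _ 2,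
    ← Real.rpow_mul n.cast_nonneg, div_eq_mul_inv (q : ℝ), ← Real.rpow_natCast _ (d - 1),
    ← Real.rpow_neg n.cast_nonneg]
  congr 2
  push_cast [hd]
  ring

lemma rho_sq_mul_le {n q : ℕ} (hd : 2 ≤ d) (hq : 0 < q) (hqn : q ≤ n) :
    rho d n q ^ 2 * ((n / q + 1) * (n + 1) ^ (d - 2)) ≤ 2 ^ (d - 1) := by
  have hqn' : (q : ℝ) ≤ n := by exact_mod_cast hqn
  have hn1 : (1 : ℝ) ≤ n := by exact_mod_cast hq.trans_le hqn
  have hq' : (q : ℝ) ≠ 0 := by exact_mod_cast hq.ne'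
  obtain ⟨k, rfl⟩ := Nat.exists_eq_add_of_le' hd
  rw [rho_sq, Nat.add_sub_cancel, show k + 2 - 1 = k + 1 by omega, div_mul_eq_mul_div,
    div_le_iff₀ (by positivity)]
  calc (q : ℝ) * ((n / q + 1) * (n + 1) ^ k) = (n + q) * (n + 1) ^ k := by field_simp
    _ ≤ (2 * n) * (2 * n) ^ k := by gcongr <;> linarith
    _ = 2 ^ (k + 1) * n ^ (k + 1) := by ring

/-- The constant in the moment bound for the block sums. -/
def momentConst (d : ℕ) : ℝ := √(258 * 768 * 48 ^ d * 2 ^ d)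

lemma two_le_momentConst (d : ℕ) : 2 ≤ momentConst d := by
  refine Real.le_sqrt_of_sq_le ?_
  have hpow : (1 : ℝ) ≤ 48 ^ d * 2 ^ d :=
    one_le_mul_of_one_le_of_one_le (one_le_pow₀ (by norm_num)) (one_le_pow₀ (by norm_num))
  linarith

theorem eLpNorm_rho_mul_blockSum_two_mul_le {n p q : ℕ} (hd : 2 ≤ d) (hp : p ≠ 0) (hq : 0 < q)
    (hpn : (4 * p : ℝ) ^ (2 * d - 3) ≤ n / q) (α : DyadicRect d → ℝ) {I : Finset ℕ}
    (hI : q * #I ≤ n + q) :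
    eLpNorm (fun x => rho d n q * blockSum n α I x) ((2 * p : ℕ) : ENNReal) (cubeMeasure d) ≤
      ENNReal.ofReal (momentConst d * √(p / 2)) := by
  have hq1 : (1 : ℝ) ≤ q := by exact_mod_cast hq
  have hp1 : (1 : ℝ) ≤ p := by exact_mod_cast Nat.one_le_iff_ne_zero.2 hp
  have hqn : q ≤ n := by
    have hone := (one_le_pow₀ (by linarith)).trans hpn
    exact_mod_cast (one_le_div (zero_lt_one.trans_le hq1)).1 hone
  have hI' : (#I : ℝ) ≤ n / q + 1 := by
    rw [← div_self (zero_lt_one.trans_le hq1).ne', ← add_div, le_div_iff₀' (by linarith)]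
    exact_mod_cast hI
  have hmn : (n / q + 1 : ℝ) ≤ n + 1 :=
    add_le_add_left (div_le_self n.cast_nonneg hq1) 1
  have hmoment := (MomentLE.sq_sum_block (isRFamily_rSample α (n + 1)) hd hI' hmn hp
    (hpn.trans (by linarith))).const_mul (sq_nonneg (rho d n q))
  simp only [← mul_pow] at hmoment
  have hmodel : (fun x => rho d n q * blockSum n α I x) =ᵐ[cubeMeasure d] fun y =>
      rho d n q * ∑ r ∈ block d n I, rSample α (n + 1) r (cubeDigits (n + 1) y) :=
    (blockSum_ae_eq n α I).mono fun y hy => congrArg _ hy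
  rw [eLpNorm_congr_ae hmodel, momentConst, ← Real.sqrt_mul (by positivity)]
  refine (hmoment.eLpNorm_comp_cubeDigits_le hp).trans
    (ENNReal.ofReal_le_ofReal (Real.sqrt_le_sqrt ?_))
  calc rho d n q ^ 2 * (258 * 768 * 48 ^ d * ((p : ℝ) * ((n / q + 1) * (n + 1) ^ (d - 2))))
      = 258 * 768 * 48 ^ d * (p : ℝ) * (rho d n q ^ 2 * ((n / q + 1) * (n + 1) ^ (d - 2))) := by
        ring
    _ ≤ 258 * 768 * 48 ^ d * (p : ℝ) * 2 ^ (d - 1) := by gcongr; exact rho_sq_mul_le hd hq hqn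
    _ = 258 * 768 * 48 ^ d * 2 ^ d * ((p : ℝ) / 2) := by
        rw [← pow_sub_one_mul (NeZero.ne d) (2 : ℝ)]
        ring

theorem eLpNorm_rho_mul_blockSum_le {n q : ℕ} {p : ℝ} (hd : 2 ≤ d) (hp : 1 ≤ p) (hq : 0 < q)
    (hpn : 8 * p ≤ (n / q : ℝ) ^ (1 / (2 * (d : ℝ) - 3))) (α : DyadicRect d → ℝ) {I : Finset ℕ}
    (hI : q * #I ≤ n + q) :
    eLpNorm (fun x => rho d n q * blockSum n α I x) (ENNReal.ofReal p) (cubeMeasure d) ≤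
      ENNReal.ofReal (momentConst d * √p) := by
  have hceil : (⌈p⌉₊ : ℝ) ≤ 2 * p := by linarith [Nat.ceil_lt_add_one (zero_le_one.trans hp)]
  have hpow : (4 * ⌈p⌉₊ : ℝ) ^ (2 * d - 3) ≤ n / q := by
    have hcast : 2 * (d : ℝ) - 3 = (2 * d - 3 : ℕ) := by
      rw [Nat.cast_sub (by omega)]
      push_cast
      ring
    rw [hcast, one_div] at hpn
    exact (pow_le_pow_left₀ (by positivity) (by linarith) _).trans_eq
      (Real.rpow_inv_natCast_pow (by positivity) (by omega))
  have hexp : ENNReal.ofReal p ≤ ((2 * ⌈p⌉₊ : ℕ) : ENNReal) := by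
    rw [← ENNReal.ofReal_natCast]
    refine ENNReal.ofReal_le_ofReal ?_
    push_cast
    linarith [Nat.le_ceil p]
  have hC := two_le_momentConst d
  calc eLpNorm (fun x => rho d n q * blockSum n α I x) (ENNReal.ofReal p) (cubeMeasure d)
      ≤ eLpNorm (fun x => rho d n q * blockSum n α I x) ((2 * ⌈p⌉₊ : ℕ) : ENNReal)
          (cubeMeasure d) :=
        eLpNorm_le_eLpNorm_of_exponent_le hexp ((aestronglyMeasurable_blockSum n α I).const_mul _)
    _ ≤ ENNReal.ofReal (momentConst d * √(⌈p⌉₊ / 2)) :=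
        eLpNorm_rho_mul_blockSum_two_mul_le hd (Nat.ceil_pos.2 (by linarith)).ne' hq hpow α hI
    _ ≤ ENNReal.ofReal (momentConst d * √p) := by
        gcongr
        linarith

end BlockSum

section Tail

variable {Ω : Type*} [MeasurableSpace Ω] {μ : Measure Ω} {f : Ω → ℝ}

lemma measure_lt_abs_le_of_eLpNorm_le {p y B : ℝ} (hf : AEStronglyMeasurable f μ) (hp : 0 < p)
    (hy : 0 < y) (hB : 0 ≤ B) (h : eLpNorm f (ENNReal.ofReal p) μ ≤ ENNReal.ofReal B) :
    μ {x | y < |f x|} ≤ ENNReal.ofReal ((B / y) ^ p) := by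
  have hmarkov := meas_ge_le_mul_pow_eLpNorm_enorm μ (by simpa using hp) ENNReal.ofReal_ne_top hf
    (ENNReal.ofReal_pos.2 hy).ne' (fun h => absurd h ENNReal.ofReal_ne_top)
  rw [ENNReal.toReal_ofReal hp.le, ← ENNReal.mul_rpow_of_nonneg _ _ hp.le] at hmarkov
  have hsub : {x | y < |f x|} ⊆ {x | ENNReal.ofReal y ≤ ‖f x‖ₑ} := fun x hx => by
    rw [Set.mem_ofPred_eq, Real.enorm_eq_ofReal_abs]
    exact ENNReal.ofReal_le_ofReal (le_of_lt hx)
  refine (measure_mono hsub).trans (hmarkov.trans ?_)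
  rw [← ENNReal.ofReal_rpow_of_nonneg (by positivity) hp.le, div_eq_inv_mul,
    ENNReal.ofReal_mul (by positivity), ENNReal.ofReal_inv_of_pos hy]
  gcongr

/-- Markov's inequality for the exponent `p = (y / (M e)) ^ 2`, at which `M √p / y = e⁻¹`. -/
lemma measure_lt_abs_le_of_forall_eLpNorm_le [IsProbabilityMeasure μ] {M N y : ℝ}
    (hf : AEStronglyMeasurable f μ) (hM : 0 < M)
    (h : ∀ p, 1 ≤ p → p ≤ N → eLpNorm f (ENNReal.ofReal p) μ ≤ ENNReal.ofReal (M * √p))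
    (hy : 0 ≤ y) (hyN : (y / (M * Real.exp 1)) ^ 2 ≤ N) :
    μ {x | y < |f x|} ≤ ENNReal.ofReal (Real.exp (1 - (y / (M * Real.exp 1)) ^ 2)) := by
  set p := (y / (M * Real.exp 1)) ^ 2 with hp_def
  rcases lt_or_ge p 1 with hp | hp
  · refine prob_le_one.trans (ENNReal.one_le_ofReal.2 (Real.one_le_exp ?_))
    linarith
  · have hy_pos : 0 < y := hy.lt_of_ne fun h0 => by
      rw [hp_def, ← h0] at hp
      norm_num at hp
    have hbase : M * √p / y = Real.exp (-1) := by
      rw [hp_def, Real.sqrt_sq (by positivity), Real.exp_neg]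
      field_simp
    have hmarkov := measure_lt_abs_le_of_eLpNorm_le hf (zero_lt_one.trans_le hp) hy_pos
      (by positivity) (h p hp hyN)
    rw [hbase, ← Real.exp_mul] at hmarkov
    exact hmarkov.trans (ENNReal.ofReal_le_ofReal (Real.exp_le_exp.2 (by linarith)))

end Tail

section Range

lemma rpow_one_div_mul_sq {x s : ℝ} (hx : 0 ≤ x) : (x ^ (1 / (2 * s))) ^ 2 = x ^ (1 / s) := by
  rw [← Real.rpow_natCast, ← Real.rpow_mul hx]
  congr 1
  push_cast
  field_simp

lemma rpow_div_le_div_rpow_one_div {n q : ℕ} {ε u v : ℝ} (hε : 0 ≤ ε) (hε1 : ε ≤ 1) (hu : 0 < u)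
    (huv : u ≤ v) (hq : 0 < q) (hn : n ≠ 0) (hqn : (q : ℝ) ≤ (n : ℝ) ^ ε) :
    (n : ℝ) ^ ((1 - 2 * ε) / v) ≤ (n / q : ℝ) ^ (1 / u) := by
  have hn1 : (1 : ℝ) ≤ n := by exact_mod_cast Nat.one_le_iff_ne_zero.2 hn
  have hexp : (1 - 2 * ε) / v ≤ (1 - ε) * (1 / u) := by
    rw [mul_one_div]
    calc (1 - 2 * ε) / v ≤ (1 - ε) / v := by gcongr <;> linarith
      _ ≤ (1 - ε) / u := by gcongr
  have hdiv : (n : ℝ) ^ (1 - ε) ≤ n / q := by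
    rw [Real.rpow_sub (by linarith), Real.rpow_one]
    gcongr
  calc (n : ℝ) ^ ((1 - 2 * ε) / v) ≤ (n : ℝ) ^ ((1 - ε) * (1 / u)) :=
        Real.rpow_le_rpow_of_exponent_le hn1 hexp
    _ = ((n : ℝ) ^ (1 - ε)) ^ (1 / u) := Real.rpow_mul n.cast_nonneg _ _
    _ ≤ (n / q : ℝ) ^ (1 / u) := Real.rpow_le_rpow (by positivity) hdiv (by positivity)

lemma rpow_div_le_div_blockCount_rpow {n : ℕ} {a ε u v : ℝ} (ha : 0 ≤ a) (ha1 : a ≤ 1)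
    (hε : 0 < ε) (hε1 : ε ≤ 1) (hu : 0 < u) (huv : u ≤ v) (hq : 0 < blockCount a ε n) :
    (n : ℝ) ^ ((1 - 2 * ε) / v) ≤ (n / blockCount a ε n : ℝ) ^ (1 / u) := by
  have hn : n ≠ 0 := by
    rintro rfl
    simp [blockCount, Real.zero_rpow hε.ne'] at hq
  exact rpow_div_le_div_rpow_one_div hε.le hε1 hu huv hq hn (blockCount_le ha ha1 ε n)

end Range

end SmallBall

end

open SmallBall in
theorem mainTheorem8_general (d : ℕ) [NeZero d] (hd : 2 ≤ d) :
    ∃ c C : ℝ, 0 < c ∧ c < 1 ∧ 0 < C ∧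
      ∀ (n q : ℕ), 0 < q → ∀ (α : DyadicRect d → ℝ) (I : Finset ℕ), q * I.card ≤ n + q →
        (∀ p : ℝ, 1 ≤ p → p ≤ c * (n / q : ℝ) ^ (1 / (2 * (d : ℝ) - 3)) →
          eLpNorm (fun x => rho d n q * blockSum n α I x) (ENNReal.ofReal p) (cubeMeasure d)
            ≤ ENNReal.ofReal (C * √p)) ∧
        (∀ y : ℝ, 0 ≤ y → y < c * (n / q : ℝ) ^ (1 / (4 * (d : ℝ) - 6)) →
          cubeMeasure d {x | y < |rho d n q * blockSum n α I x|}
            ≤ ENNReal.ofReal (C * Real.exp (-c * y ^ 2))) := by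
  set M := momentConst d
  have hM : 2 ≤ M := two_le_momentConst d
  have hMe : 4 ≤ M * Real.exp 1 := by nlinarith [Real.exp_one_gt_d9]
  obtain ⟨c, hc⟩ : ∃ c, c = 1 / (M * Real.exp 1) ^ 2 := ⟨_, rfl⟩
  have hc_pos : 0 < c := hc ▸ by positivity
  have hc_le : c ≤ 1 / 8 := hc ▸ one_div_le_one_div_of_le (by norm_num) (by nlinarith)
  refine ⟨c, M + Real.exp 1, hc_pos, by linarith, by positivity, fun n q hq α I hI => ?_⟩
  set N : ℝ := (n / q : ℝ) ^ (1 / (2 * (d : ℝ) - 3))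
  have hN : 0 ≤ N := by positivity
  have hnorm (p : ℝ) (hp : 1 ≤ p) (hpN : p ≤ N / 8) :=
    eLpNorm_rho_mul_blockSum_le hd hp hq (by linarith : 8 * p ≤ N) α hI
  refine ⟨fun p hp hpN => (hnorm p hp (by nlinarith)).trans ?_, fun y hy hyN => ?_⟩
  · gcongr
    linarith [Real.exp_pos 1]
  · rw [show 4 * (d : ℝ) - 6 = 2 * (2 * d - 3) by ring] at hyN
    have hy_sq : y ^ 2 ≤ c ^ 2 * N :=
      (pow_le_pow_left₀ hy hyN.le 2).trans_eq
        (by rw [mul_pow, rpow_one_div_mul_sq (by positivity)])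
    have hexp : (y / (M * Real.exp 1)) ^ 2 = c * y ^ 2 := by rw [hc, div_pow]; ring
    refine (measure_lt_abs_le_of_forall_eLpNorm_le
      ((aestronglyMeasurable_blockSum n α I).const_mul _) (by linarith) hnorm hy ?_).trans ?_
    · calc (y / (M * Real.exp 1)) ^ 2 ≤ c * (c ^ 2 * N) := by rw [hexp]; gcongr
        _ = c ^ 3 * N := by ring
        _ ≤ 1 / 8 * N := by
          gcongr
          exact (pow_le_of_le_one hc_pos.le (by linarith) three_ne_zero).trans hc_le
        _ = N / 8 := by ring
    · rw [hexp, sub_eq_add_neg, Real.exp_add, ← neg_mul]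
      gcongr
      linarith

theorem mainTheorem8 (d : ℕ) [NeZero d] (hd : 3 ≤ d) :
    ∃ c C : ℝ, 0 < c ∧ c < 1 ∧ 0 < C ∧
      ∀ (ε a : ℝ), 0 < ε → ε < 1 → 0 < a → a ≤ 1 →
      ∀ (n : ℕ) (e : ℕ → ℕ),
        SmallBall.IsEqualDivision n (SmallBall.blockCount a ε n) e →
      ∀ (α : SmallBall.DyadicRect d → ℝ) (t : ℕ), t < SmallBall.blockCount a ε n →
        (∀ p : ℝ, 1 ≤ p → p ≤ c * (n : ℝ) ^ ((1 - 2 * ε) / (2 * (d : ℝ) - 1)) →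
          eLpNorm
              (fun x => SmallBall.rho d n (SmallBall.blockCount a ε n) *
                SmallBall.blockSum n α (Finset.Ioc (e t) (e (t + 1))) x)
              (ENNReal.ofReal p) (SmallBall.cubeMeasure d)
            ≤ ENNReal.ofReal (C * √p)) ∧
        (∀ y : ℝ, 0 ≤ y → y < c * (n : ℝ) ^ ((1 - 2 * ε) / (4 * (d : ℝ) - 2)) →
          SmallBall.cubeMeasure d
              {x | y < |SmallBall.rho d n (SmallBall.blockCount a ε n) *
                SmallBall.blockSum n α (Finset.Ioc (e t) (e (t + 1))) x|}
            ≤ ENNReal.ofReal (C * Real.exp (-c * y ^ 2))) := by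
  obtain ⟨c, C, hc, hc1, hC, h⟩ := mainTheorem8_general d (by omega)
  refine ⟨c, C, hc, hc1, hC, fun ε a hε hε1 ha ha1 n e he α t ht => ?_⟩
  have hd' : (3 : ℝ) ≤ d := by exact_mod_cast hd
  have hq := Nat.zero_lt_of_lt ht
  have hrange {u v : ℝ} (hu : 0 < u) (huv : u ≤ v) :=
    SmallBall.rpow_div_le_div_blockCount_rpow ha.le ha1 hε hε1.le hu huv hq
  obtain ⟨hnorm, htail⟩ := h n _ hq α (Finset.Ioc (e t) (e (t + 1)))
    (by rw [Nat.card_Ioc]; exact he.mul_le ht)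
  exact ⟨fun p hp hpn => hnorm p hp
      (hpn.trans (mul_le_mul_of_nonneg_left (hrange (by linarith) (by linarith)) hc.le)),
    fun y hy hyn => htail y hy
      (hyn.trans_le (mul_le_mul_of_nonneg_left (hrange (by linarith) (by linarith)) hc.le))⟩
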